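/- **Notation.** Let $\mathbb{F}$ be a finite field and let $\mathbb{F}[t]^+$ be the set of monic polynomials over $\mathbb{F}$. For nonzero $Q\in\mathbb{F}[t]$ put $|Q|=|\mathbb{F}|^{\deg Q}$. For $Q\in\mathbb{F}[t]^+$ let $\mathbb{F}[t]_Q=\mathbb{F}[t]/Q\mathbb{F}[t]$, and let $\mathrm{lpf}(Q)$ be the minimum of $|R|$ over the monic irreducible factors $R$ of $Q$ (so below $Q\neq 1$; for $Q=1$ every assertion is trivial). For a finite set $S$ and $f:S\to\mathbb{C}$ write $\mathbb{E}_{x\in S}f(x)=\frac1{|S|}\sum_{x\in S}f(x)$ and $\|f\|_{L^2(S)}=\left(\mathbb{E}_{x\in S}|f(x)|^2\right)^{1/2}$. For $P(y)\in(\mathbb{F}[t])[y]$ and $Q\in\mathbb{F}[t]^+$ put $$D_P(Q)=\sup_{\|f\|_{L^2(\mathbb{F}[t]_Q)}=1}\Big\|\mathbb{E}_{y\in\mathbb{F}[t]_Q}f(x+P(y))-\mathbb{E}_{z\in\mathbb{F}[t]_Q}f(z)\Big\|_{L^2(\mathbb{F}[t]_Q)},$$ where $f$ ranges over functions $\mathbb{F}[t]_Q\to\mathbb{C}$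 and the outer norm is taken in the variable $x$. A Følner sequence in $\mathbb{F}[t]$ is a sequence $(\Phi_N)_{N\in\mathbb{N}}$ of nonempty finite subsets with $|(\Phi_N+n)\triangle\Phi_N|/|\Phi_N|\to0$ for every $n\in\mathbb{F}[t]$. A map $a:\mathbb{F}[t]\to\mathbb{F}((t^{-1}))$ is well distributed mod $\mathbb{F}[t]$ if $\lim_{N\to\infty}\mathbb{E}_{n\in\Phi_N}f(a(n))=\int f\,dm$ for every continuous $f:\mathbb{F}((t^{-1}))/\mathbb{F}[t]\to\mathbb{C}$ and every Følner sequence $(\Phi_N)$, where $m$ is the Haar probability measure on the compact group $\mathbb{F}((t^{-1}))/\mathbb{F}[t]$. The polynomial $P$ is good for irrational equidistribution if $(P(n)\alpha)_{n\in\mathbb{F}[t]}$ is well distributed mod $\mathbb{F}[t]$ for every $\alpha\in\mathbb{F}((t^{-1}))\setminus\mathbb{F}(t)$. **Theorem.** Let $P(y)\in(\mathbb{F}[t])[y]$ be a polynomial of positive degree in $y$. The following are equivalent: (i) $D_P(Q)\to0$ as $\mathrm{lpf}(Q)\to\infty$, $Q\in\mathbb{F}[t]^+$; that is, for every $\varepsilon>0$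 there is $N$ such that $D_P(Q)\le\varepsilon$ for all $Q\in\mathbb{F}[t]^+$ with $\mathrm{lpf}(Q)\ge N$; (ii) there exist $C_1,C_2,\gamma>0$ such that $D_P(Q)\le C_2\,\mathrm{lpf}(Q)^{-\gamma}$ for every $Q\in\mathbb{F}[t]^+$ with $\mathrm{lpf}(Q)\ge C_1$; (iii) there exists $C>0$ such that $H+Q\mathbb{F}[t]=\mathbb{F}[t]$ for every $Q\in\mathbb{F}[t]^+$ with $\mathrm{lpf}(Q)\ge C$, where $H\le(\mathbb{F}[t],+)$ is the group generated by $\{P(y)-P(0):y\in\mathbb{F}[t]\}$; (iv) for every $\delta>0$ there exists $N>0$ such that if $Q\in\mathbb{F}[t]^+$ has $\mathrm{lpf}(Q)\ge N$ and $A,B\subseteq\mathbb{F}[t]_Q$ satisfy $|A||B|\ge\delta|Q|^2$, then there exist $x,y\in\mathbb{F}[t]_Q$ with $x\in A$ and $x+P(y)\in B$; (v) there exist $C_1,C_2,\gamma>0$ such that for every $Q\in\mathbb{F}[t]^+$ with $\mathrm{lpf}(Q)\ge C_1$ and all $A,B\subseteq\mathbb{F}[t]_Q$, $$\Big|\,\big|\{(x,y)\in\mathbb{F}[t]_Q^2:x\in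 A,\ x+P(y)\in B\}\big|-|A||B|\,\Big|\le C_2\,|A|^{1/2}|B|^{1/2}\,|Q|\,\mathrm{lpf}(Q)^{-\gamma}.$$ Moreover, if $P$ is good for irrational equidistribution, then each of the properties (i)–(v) holds. -/

import Mathlib

open Polynomial Filter Topology MeasureTheory
open scoped BigOperators

noncomputable section

namespace PolyEquidist

/-! ### The quotient rings `𝔽[t]_Q` and the size of the least prime factor

Throughout, `F[X]` is the polynomial ring `𝔽[t]` (its variable `X` is `t`), and a polynomial
`P(y)` with coefficients in `𝔽[t]` is an element of `F[X][X]`. -/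

/-- The set `𝔽[t]⁺` of monic polynomials. -/
abbrev MonicPoly (F : Type*) [Field F] : Type _ := {Q : F[X] // Q.Monic}

/-- The quotient ring `𝔽[t]_Q = 𝔽[t] / Q 𝔽[t]`. -/
abbrev QuotRing {F : Type*} [Field F] (Q : MonicPoly F) : Type _ := F[X] ⧸ Ideal.span {Q.1}

instance finite_quotRing {F : Type*} [Field F] [Fintype F] (Q : MonicPoly F) :
    Finite (QuotRing Q) := by
  have : Module.Finite F (F[X] ⧸ Ideal.span {Q.1}) := Q.2.finite_quotient
  exact Module.finite_of_finite F

instance fintypeQuotRing {F : Type*} [Field F] [Fintype F] (Q : MonicPoly F) :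
    Fintype (QuotRing Q) := Fintype.ofFinite _

/-- `lpf(Q)`: the least absolute value `|R| = |𝔽| ^ deg R` of a monic irreducible factor `R` of
`Q`. (For `Q = 1`, which has no such factor, the infimum of the empty set is `0` here.) -/
def lpf {F : Type*} [Field F] [Fintype F] (Q : MonicPoly F) : ℤ :=
  sInf {n : ℤ | ∃ R : F[X], R.Monic ∧ Irreducible R ∧ R ∣ Q.1 ∧ cardPowDegree R = n}

/-! ### The five properties -/

/-- The `L²` norm on a finite set with respect to the normalized counting measure. -/
def l2Norm {S : Type*} [Fintype S] (f : S → ℂ) : ℝ := √(𝔼 x, ‖f x‖ ^ 2)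

/-- The function `x ↦ 𝔼_y f(x + P(y)) - 𝔼_z f(z)` on `𝔽[t]_Q`. -/
def discrepancy {F : Type*} [Field F] [Fintype F] (P : F[X][X]) (Q : MonicPoly F)
    (f : QuotRing Q → ℂ) : QuotRing Q → ℂ :=
  fun x => (𝔼 y, f (x + aeval y P)) - (𝔼 z, f z)

/-- The supremum over all `f` with `‖f‖ = 1` of `‖𝔼_y f(x + P(y)) - 𝔼_z f(z)‖`, both norms being
those of `L²(𝔽[t]_Q)`. -/
def supDiscrepancy {F : Type*} [Field F] [Fintype F] (P : F[X][X]) (Q : MonicPoly F) : ℝ :=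
  ⨆ f : {f : QuotRing Q → ℂ // l2Norm f = 1}, l2Norm (discrepancy P Q f.1)

/-- The family whose supremum is taken in `supDiscrepancy` is bounded. -/
theorem bddAbove_discrepancy {F : Type*} [Field F] [Fintype F] (P : F[X][X]) (Q : MonicPoly F) :
    BddAbove (Set.range fun f : {f : QuotRing Q → ℂ // l2Norm f = 1} =>
      l2Norm (discrepancy P Q f.1)) := by
  set M : ℝ := √(Fintype.card (QuotRing Q))
  have hM : 0 ≤ M := Real.sqrt_nonneg _
  refine ⟨2 * M, ?_⟩
  rintro _ ⟨⟨f, hf⟩, rfl⟩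
  have h1 : ∑ x, ‖f x‖ ^ 2 = Fintype.card (QuotRing Q) := by
    have h2 : 𝔼 x, ‖f x‖ ^ 2 = 1 := by
      have := hf
      rwa [l2Norm, Real.sqrt_eq_one] at this
    rw [← Fintype.card_mul_expect, h2, mul_one]
  have hfM : ∀ x, ‖f x‖ ≤ M := fun x => by
    refine Real.le_sqrt_of_sq_le ?_
    rw [← h1]
    exact Finset.single_le_sum (f := fun x => ‖f x‖ ^ 2) (fun _ _ => by positivity)
      (Finset.mem_univ x)
  have hE : ∀ g : QuotRing Q → QuotRing Q, ‖𝔼 y, f (g y)‖ ≤ M := fun g => by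
    exact (RCLike.norm_expect_le (K := ℝ)).trans
      (Finset.expect_le Finset.univ_nonempty fun y _ => hfM _)
  refine Real.sqrt_le_iff.2 ⟨by positivity, Finset.expect_le Finset.univ_nonempty fun x _ => ?_⟩
  have : ‖discrepancy P Q f x‖ ≤ 2 * M := by
    refine (norm_sub_le _ _).trans ?_
    have h3 := hE fun y => x + aeval y P
    have h4 := hE fun z => z
    linarith
  gcongr

/-- The family whose supremum is taken in `supDiscrepancy` is nonempty. -/
instance nonempty_unitSphere {F : Type*} [Field F] [Fintype F] (Q : MonicPoly F) :
    Nonempty {f : QuotRing Q → ℂ // l2Norm f = 1} :=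
  ⟨fun _ => 1, by simp [l2Norm, Finset.expect_const]⟩

/-- Property (i): the supremum is `o(1)` as `lpf(Q) → ∞`. -/
def QualitativeL2 {F : Type*} [Field F] [Fintype F] (P : F[X][X]) : Prop :=
  Tendsto (fun Q : MonicPoly F => supDiscrepancy P Q) (comap lpf atTop) (𝓝 0)

/-- Property (ii): the supremum is `O(lpf(Q) ^ (-γ))` for some `γ > 0`. -/
def PowerSavingL2 {F : Type*} [Field F] [Fintype F] (P : F[X][X]) : Prop :=
  ∃ C₁ C₂ γ : ℝ, 0 < C₁ ∧ 0 < C₂ ∧ 0 < γ ∧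
    ∀ Q : MonicPoly F, C₁ ≤ (lpf Q : ℝ) → supDiscrepancy P Q ≤ C₂ * (lpf Q : ℝ) ^ (-γ)

/-- The subgroup `H` of `(𝔽[t], +)` generated by the values `P(y) - P(0)`, `y ∈ 𝔽[t]`. -/
def valueGroup {F : Type*} [Field F] (P : F[X][X]) : AddSubgroup F[X] :=
  AddSubgroup.closure (Set.range fun y : F[X] => P.eval y - P.eval 0)

/-- Property (iii): `H + Q 𝔽[t] = 𝔽[t]` whenever `lpf(Q)` is large enough. -/
def FullValueGroup {F : Type*} [Field F] [Fintype F] (P : F[X][X]) : Prop :=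
  ∃ C : ℝ, 0 < C ∧ ∀ Q : MonicPoly F, C ≤ (lpf Q : ℝ) →
    valueGroup P ⊔ (Ideal.span {Q.1}).toAddSubgroup = ⊤

/-- Property (iv): the two-set Sárközy property. -/
def TwoSetSarkozy {F : Type*} [Field F] [Fintype F] (P : F[X][X]) : Prop :=
  ∀ δ : ℝ, 0 < δ → ∃ N : ℝ, 0 < N ∧ ∀ Q : MonicPoly F, N ≤ (lpf Q : ℝ) →
    ∀ A B : Finset (QuotRing Q),
      δ * (cardPowDegree Q.1 : ℝ) ^ 2 ≤ (A.card : ℝ) * (B.card : ℝ) →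
        ∃ x y : QuotRing Q, x ∈ A ∧ x + aeval y P ∈ B

/-- Property (v): the number of `(x, y)` with `x ∈ A` and `x + P(y) ∈ B` is `|A| |B|` up to a
power-saving error. -/
def PowerSavingCount {F : Type*} [Field F] [Fintype F] (P : F[X][X]) : Prop :=
  ∃ C₁ C₂ γ : ℝ, 0 < C₁ ∧ 0 < C₂ ∧ 0 < γ ∧
    ∀ Q : MonicPoly F, C₁ ≤ (lpf Q : ℝ) → ∀ A B : Finset (QuotRing Q),
      |(Nat.card {xy : QuotRing Q × QuotRing Q // xy.1 ∈ A ∧ xy.1 + aeval xy.2 P ∈ B} : ℝ)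
          - (A.card : ℝ) * (B.card : ℝ)|
        ≤ C₂ * √(A.card : ℝ) * √(B.card : ℝ) * (cardPowDegree Q.1 : ℝ) * (lpf Q : ℝ) ^ (-γ)

/-! ### Well-distribution modulo `𝔽[t]`

The field `𝔽((t⁻¹))` is the field of Laurent series over `𝔽` in one variable, which stands for
`t⁻¹`: the coefficient of `t ^ j` in `α` is `α.coeff (-j)`. Mathlib's topology on it is given by
the valuation of Laurent series, i.e. by `|α| = |𝔽| ^ j` for `j` the degree of `α` in `t`. -/

/-- The embedding of `𝔽[t]` in `𝔽((t⁻¹))`, which maps `t` to the inverse of the variable. -/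
def embed (F : Type*) [Field F] : F[X] →+* LaurentSeries F :=
  eval₂RingHom HahnSeries.C (HahnSeries.single (-1 : ℤ) (1 : F))

/-- `α ∈ 𝔽((t⁻¹))` is rational if it lies in `𝔽(t)`. -/
def IsRational {F : Type*} [Field F] (α : LaurentSeries F) : Prop :=
  ∃ m n : F[X], n ≠ 0 ∧ α = embed F m / embed F n

/-- The compact group `𝔽((t⁻¹)) / 𝔽[t]`. -/
abbrev Torus (F : Type*) [Field F] : Type _ :=
  LaurentSeries F ⧸ (embed F).toAddMonoidHom.range

/-- The series `∑_{j ≥ 1} c_{j-1} t ^ (-j)`. -/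
def fracSeries {F : Type*} [Field F] (c : ℕ → F) : LaurentSeries F :=
  HahnSeries.single (1 : ℤ) (1 : F) * HahnSeries.ofPowerSeries ℤ F (PowerSeries.mk c)

theorem coeff_fracSeries {F : Type*} [Field F] (c : ℕ → F) (j : ℕ) :
    (fracSeries c).coeff (j + 1) = c j := by
  have := HahnSeries.coeff_single_mul_add (r := (1 : F))
    (x := HahnSeries.ofPowerSeries ℤ F (PowerSeries.mk c)) (a := (j : ℤ)) (b := 1)
  rw [fracSeries, this, one_mul, LaurentSeries.coeff_coe_powerSeries, PowerSeries.coeff_mk]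

theorem coeff_fracSeries_of_le {F : Type*} [Field F] (c : ℕ → F) {n : ℤ} (hn : n ≤ 0) :
    (fracSeries c).coeff n = 0 := by
  have := HahnSeries.coeff_single_mul_add (r := (1 : F))
    (x := HahnSeries.ofPowerSeries ℤ F (PowerSeries.mk c)) (a := n - 1) (b := 1)
  rw [sub_add_cancel] at this
  rw [fracSeries, this, one_mul, PowerSeries.coeff_coe, if_pos (by omega)]

theorem embed_monomial {F : Type*} [Field F] (k : ℕ) (r : F) :
    embed F (monomial k r) = HahnSeries.single (-k : ℤ) r := by
  rw [embed, coe_eval₂RingHom, eval₂_monomial, HahnSeries.single_pow]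
  simp [HahnSeries.C_apply]

theorem coeff_embed {F : Type*} [Field F] (f : F[X]) (n : ℤ) :
    (embed F f).coeff n = if n ≤ 0 then f.coeff n.natAbs else 0 := by
  induction f using Polynomial.induction_on' with
  | add p q hp hq => rw [map_add, HahnSeries.coeff_add, hp, hq]; split_ifs <;> simp
  | monomial k r =>
    rw [embed_monomial, HahnSeries.coeff_single, coeff_monomial]
    split_ifs <;> first | rfl | omega

/-- Every element of `𝔽((t⁻¹))` is a polynomial in `t` plus a series in negative powers of `t`. -/
theorem exists_embed_add_fracSeries {F : Type*} [Field F] (α : LaurentSeries F) :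
    ∃ (f : F[X]) (c : ℕ → F), α = embed F f + fracSeries c := by
  obtain ⟨N, hN⟩ : ∃ N : ℕ, ∀ n : ℕ, N < n → α.coeff (-n : ℤ) = 0 := by
    refine ⟨α.order.natAbs, fun n hn => HahnSeries.coeff_eq_zero_of_lt_order ?_⟩
    omega
  refine ⟨∑ k ∈ Finset.range (N + 1), monomial k (α.coeff (-k : ℤ)),
    fun j => α.coeff (j + 1), ?_⟩
  ext n
  rw [HahnSeries.coeff_add, coeff_embed]
  rcases le_or_gt n 0 with hn | hn
  · obtain ⟨m, rfl⟩ : ∃ m : ℕ, n = -m := ⟨n.natAbs, by omega⟩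
    rw [if_pos hn, coeff_fracSeries_of_le _ hn, add_zero, finsetSum_coeff]
    simp only [coeff_monomial, Int.natAbs_neg, Int.natAbs_natCast, Finset.sum_ite_eq',
      Finset.mem_range]
    split_ifs with h
    · rfl
    · exact hN m (by omega)
  · obtain ⟨m, rfl⟩ : ∃ m : ℕ, n = m + 1 := ⟨(n - 1).natAbs, by omega⟩
    rw [if_neg (by omega), zero_add, coeff_fracSeries]

theorem continuous_fracSeries {F : Type*} [Field F] [TopologicalSpace F] [DiscreteTopology F] :
    Continuous (fracSeries : (ℕ → F) → LaurentSeries F) := by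
  refine continuous_iff_continuousAt.2 fun c U hU => ?_
  obtain ⟨γ, hγ⟩ := Valued.mem_nhds.mp hU
  set g : WithZero (Multiplicative ℤ) := MonoidWithZeroHom.ValueGroup₀.embedding γ.1
  have hg : g ≠ 0 := by simp [g]
  set D : ℤ := -(WithZero.log g - 1)
  have hD : WithZero.exp (-D) < g := by
    rw [← WithZero.lt_log_iff_exp_lt hg]
    simp [D]
  have hopen : {d : ℕ → F | ∀ j ∈ Finset.range D.toNat, d j = c j} ∈ 𝓝 c := by
    refine IsOpen.mem_nhds ?_ fun j _ => rfl
    have : {d : ℕ → F | ∀ j ∈ Finset.range D.toNat, d j = c j} =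
        ⋂ j ∈ Finset.range D.toNat, (fun d : ℕ → F => d j) ⁻¹' {c j} := by
      ext; simp
    rw [this]
    exact isOpen_biInter_finset fun j _ => (isOpen_discrete _).preimage (continuous_apply j)
  refine Filter.mem_map.2 (Filter.mem_of_superset hopen fun d hd => hγ ?_)
  simp only [Set.mem_ofPred_eq]
  rw [Valued.v.restrict_lt_iff_lt_embedding]
  refine lt_of_le_of_lt ((LaurentSeries.valuation_le_iff_coeff_lt_eq_zero F).mpr ?_) hD
  intro n hn
  rw [HahnSeries.coeff_sub, sub_eq_zero]
  rcases le_or_gt n 0 with h0 | h0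
  · rw [coeff_fracSeries_of_le _ h0, coeff_fracSeries_of_le _ h0]
  · obtain ⟨m, rfl⟩ : ∃ m : ℕ, n = m + 1 := ⟨(n - 1).natAbs, by omega⟩
    rw [coeff_fracSeries, coeff_fracSeries]
    exact hd m (by simp; omega)

instance compactSpace_torus (F : Type*) [Field F] [Fintype F] : CompactSpace (Torus F) := by
  let _ : TopologicalSpace F := ⊥
  have : DiscreteTopology F := ⟨rfl⟩
  have hc : Continuous fun c : ℕ → F => (QuotientAddGroup.mk (fracSeries c) : Torus F) :=
    continuous_quotient_mk'.comp continuous_fracSeries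
  have hs : Function.Surjective fun c : ℕ → F =>
      (QuotientAddGroup.mk (fracSeries c) : Torus F) := by
    intro x
    obtain ⟨α, rfl⟩ := QuotientAddGroup.mk_surjective x
    obtain ⟨f, c, rfl⟩ := exists_embed_add_fracSeries α
    refine ⟨c, QuotientAddGroup.eq.2 ⟨f, ?_⟩⟩
    simp
  exact ⟨hs.range_eq ▸ isCompact_range hc⟩

instance measurableSpaceTorus (F : Type*) [Field F] : MeasurableSpace (Torus F) := borel _

instance borelSpace_torus (F : Type*) [Field F] : BorelSpace (Torus F) := ⟨rfl⟩

/-- The Haar probability measure on `𝔽((t⁻¹)) / 𝔽[t]`. -/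
def torusHaar (F : Type*) [Field F] [Fintype F] : Measure (Torus F) :=
  Measure.addHaarMeasure ⊤

open scoped Classical in
/-- Følner sequences of finite (nonempty) subsets of `𝔽[t]`. -/
structure IsFolner {F : Type*} [Field F] (Φ : ℕ → Finset F[X]) : Prop where
  nonempty : ∀ N, (Φ N).Nonempty
  tendsto : ∀ n : F[X], Tendsto
    (fun N => ((symmDiff ((Φ N).image (· + n)) (Φ N)).card : ℝ) / ((Φ N).card : ℝ)) atTop (𝓝 0)

/-- `a : 𝔽[t] → 𝔽((t⁻¹))` is well distributed mod `𝔽[t]`. -/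
def WellDistributed {F : Type*} [Field F] [Fintype F] (a : F[X] → LaurentSeries F) : Prop :=
  ∀ f : Torus F → ℂ, Continuous f → ∀ Φ : ℕ → Finset F[X], IsFolner Φ →
    Tendsto (fun N => 𝔼 n ∈ Φ N, f (QuotientAddGroup.mk (a n))) atTop (𝓝 (∫ x, f x ∂torusHaar F))

/-- `P` is good for irrational equidistribution: `(P(n) α)_{n ∈ 𝔽[t]}` is well distributed mod
`𝔽[t]` for every irrational `α`. -/
def GoodForIrrationalEquidistribution {F : Type*} [Field F] [Fintype F] (P : F[X][X]) : Prop :=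
  ∀ α : LaurentSeries F, ¬ IsRational α → WellDistributed fun n => embed F (P.eval n) * α

end PolyEquidist

end

noncomputable section

namespace PolyEquidist

open scoped ComplexConjugate

/-! Averaging translates by `P(y)` acts diagonally on the characters of the quotient ring, with the
mean of `χ(P(y))` as multiplier. The obstruction to mixing is a nontrivial `χ` that is constant on
the values of `P`. Such a `χ` exists exactly when `H + Q𝔽[t]` is proper
(`addChar_eq_one_of_trivial`, `exists_functional_of_ne_top`), and it violates (i) and (iv) outright.
Without an obstruction, `norm_expect_addChar_aeval_le` bounds every nontrivial mean by a negative
power of `lpf Q`. Diagonalization turns this into (ii), and Cauchy–Schwarz into (v).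

For the bound, Frobenius is additive in characteristic `p`, so the monomials `y ^ (r p^k)` with `r`
fixed contribute one character of `y ^ r`. Up to a constant, `χ(P(y))` is then a product of
characters of `y ^ r` with `p ∤ r`. In `exists_maximal_norm_expect_le` the variable is shifted along
an element `a` that a maximal ideal multiplies into the ideal of trivial directions. If `a²` is
trivial the sum becomes linear in the shift. Otherwise `a` yields an idempotent that splits off a
residue field. Over that field Weyl differencing works (`norm_expect_addChar_sum_le`), because a
Frobenius-invariant character allows exponents divisible by `p` to be removed by taking `p`-power
roots of the coefficients.

For the last claim, residue and trace represent the functionals `𝔽[t] → 𝔽_p` by Laurent series. A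
series annihilating `H` must be rational, since `P(n)α` would otherwise fail to equidistribute. So
the annihilator of `H` is countable. It is also the dual of an `𝔽_p`-space, hence finite, and each
of its nonzero elements can vanish on `Q𝔽[t]` only for `Q` with bounded `lpf`. -/

/-! ### Averages over finite sets -/

/-- The van der Corput inequality on a finite abelian group. -/
theorem norm_expect_sq_le {G : Type*} [AddCommGroup G] [Fintype G] (f : G → ℂ) :
    ‖𝔼 y, f y‖ ^ 2 ≤ 𝔼 h, ‖𝔼 y, f (y + h) * conj (f y)‖ := by
  have h1 : (𝔼 y, f y) * conj (𝔼 y, f y) = 𝔼 h, 𝔼 y, f (y + h) * conj (f y) := by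
    have h2 : conj (𝔼 y, f y) = 𝔼 y, conj (f y) := by
      simp [Fintype.expect_eq_sum_div_card]
    rw [h2, Finset.expect_comm, mul_comm, Finset.expect_mul]
    refine Finset.expect_congr rfl fun y _ => ?_
    rw [Finset.mul_expect]
    refine Fintype.expect_equiv (Equiv.subRight y) _ _ fun h => ?_
    simp [mul_comm]
  calc ‖𝔼 y, f y‖ ^ 2 = ‖(𝔼 y, f y) * conj (𝔼 y, f y)‖ := by
        rw [norm_mul, RCLike.norm_conj, sq]
    _ ≤ _ := by
        rw [h1]
        exact RCLike.norm_expect_le (K := ℝ)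

theorem expect_le_card_div_add {ι : Type*} [Fintype ι] [Nonempty ι] (g : ι → ℝ) (bad : Finset ι)
    {B : ℝ} (hB : 0 ≤ B) (h1 : ∀ i, g i ≤ 1) (h2 : ∀ i ∉ bad, g i ≤ B) :
    𝔼 i, g i ≤ bad.card / Fintype.card ι + B := by
  classical
  calc 𝔼 i, g i ≤ 𝔼 i, ((if i ∈ bad then (1 : ℝ) else 0) + B) := by
        refine Finset.expect_le_expect fun i _ => ?_
        split_ifs with h
        · linarith [h1 i]
        · linarith [h2 i h]
    _ = _ := by
        rw [Finset.expect_add_distrib, Fintype.expect_const, Fintype.expect_eq_sum_div_card]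
        simp

theorem norm_expect_le_one {ι : Type*} [Fintype ι] [Nonempty ι] (f : ι → ℂ)
    (h : ∀ i, ‖f i‖ ≤ 1) : ‖𝔼 i, f i‖ ≤ 1 :=
  (RCLike.norm_expect_le (K := ℝ)).trans
    (Finset.expect_le Finset.univ_nonempty fun i _ => h i)

/-! ### Exponents prime to the characteristic -/

/-- The exponents `r ≤ D` that are not divisible by `p`. -/
def coprimeExponents (p D : ℕ) : Finset ℕ := (Finset.range (D + 1)).filter fun r => ¬ p ∣ r

theorem mem_coprimeExponents {p D r : ℕ} : r ∈ coprimeExponents p D ↔ r ≤ D ∧ ¬ p ∣ r := by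
  simp [coprimeExponents]

theorem pos_of_mem_coprimeExponents {p D r : ℕ} (h : r ∈ coprimeExponents p D) : 0 < r :=
  Nat.pos_of_ne_zero fun h0 => (mem_coprimeExponents.1 h).2 (h0 ▸ dvd_zero p)

theorem ordCompl_mem_coprimeExponents {p D j : ℕ} (hp : p.Prime) (hj : j ∈ Finset.Icc 1 D) :
    ordCompl[p] j ∈ coprimeExponents p D := by
  rw [Finset.mem_Icc] at hj
  exact mem_coprimeExponents.2
    ⟨(Nat.ordCompl_le _ _).trans hj.2, Nat.not_dvd_ordCompl hp (by omega)⟩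

theorem coprimeExponents_succ_of_dvd {p D : ℕ} (h : p ∣ D + 1) :
    coprimeExponents p (D + 1) = coprimeExponents p D := by
  ext r
  rw [mem_coprimeExponents, mem_coprimeExponents]
  refine and_congr_left fun hr => ⟨fun h' => ?_, fun h' => by omega⟩
  rcases h'.lt_or_eq with h' | rfl
  · omega
  · exact absurd h hr

theorem coprimeExponents_succ_of_not_dvd {p D : ℕ} (h : ¬ p ∣ D + 1) :
    coprimeExponents p (D + 1) = insert (D + 1) (coprimeExponents p D) := by
  ext r
  rw [Finset.mem_insert, mem_coprimeExponents, mem_coprimeExponents]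
  constructor
  · rintro ⟨h1, h2⟩
    by_cases h3 : r = D + 1
    · exact Or.inl h3
    · exact Or.inr ⟨by omega, h2⟩
  · rintro (rfl | ⟨h1, h2⟩)
    · exact ⟨le_rfl, h⟩
    · exact ⟨by omega, h2⟩

theorem succ_not_mem_coprimeExponents {p D : ℕ} : D + 1 ∉ coprimeExponents p D := fun h => by
  have := (mem_coprimeExponents.1 h).1
  omega

/-! ### Exponential sums over a finite field -/

section Difference

variable {K : Type*} [Field K]

/-- The coefficient of `y ^ j` in `G(y + h) - G(y)`, as a polynomial in `h`. -/
def differenceCoeff (G : K[X]) (j : ℕ) : K[X] := hasseDeriv j G - C (G.coeff j)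

theorem coeff_taylor_sub (G : K[X]) (h : K) (j : ℕ) :
    (taylor h G - G).coeff j = (differenceCoeff G j).eval h := by
  simp [differenceCoeff, taylor_coeff]

theorem natDegree_differenceCoeff_le (G : K[X]) (j : ℕ) :
    (differenceCoeff G j).natDegree ≤ G.natDegree - j := by
  refine (natDegree_sub_le _ _).trans ?_
  simp [natDegree_hasseDeriv_le]

theorem natDegree_taylor_sub_le {D : ℕ} {G : K[X]} (hG : G.natDegree ≤ D + 1) (h : K) :
    (taylor h G - G).natDegree ≤ D := by
  rw [natDegree_le_iff_coeff_eq_zero]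
  intro j hj
  rw [coeff_taylor_sub]
  have h1 : (differenceCoeff G j).natDegree = 0 := by
    have := natDegree_differenceCoeff_le G j
    omega
  have h2 : (differenceCoeff G j).coeff 0 = 0 := by
    simp [differenceCoeff, hasseDeriv_coeff]
  rw [eq_C_of_natDegree_eq_zero h1, h2]
  simp

/-- The second-highest degree survives differencing linearly in `h`. Taking the derivative records
this in a form insensitive to the `p`-th powers added later. -/
theorem derivative_differenceCoeff {D : ℕ} {G : K[X]} (hG : G.natDegree ≤ D + 1) :
    derivative (differenceCoeff G D) = C ((D + 1) * G.coeff (D + 1)) := by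
  have h1 : derivative (hasseDeriv D G) = (D + 1) • hasseDeriv (D + 1) G := by
    have := LinearMap.congr_fun (hasseDeriv_comp (R := K) 1 D) G
    rwa [LinearMap.comp_apply, hasseDeriv_one, add_comm 1 D, Nat.choose_one_right] at this
  have h2 : hasseDeriv (D + 1) G = C (G.coeff (D + 1)) := by
    have h3 : (hasseDeriv (D + 1) G).natDegree = 0 := by
      have := natDegree_hasseDeriv_le G (D + 1)
      omega
    rw [eq_C_of_natDegree_eq_zero h3]
    simp [hasseDeriv_coeff]
  rw [differenceCoeff, derivative_sub, derivative_C, sub_zero, h1, h2]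
  simp

end Difference

theorem addChar_map_sum {A M ι : Type*} [AddCommMonoid A] [CommMonoid M] (ψ : AddChar A M)
    (s : Finset ι) (f : ι → A) : ψ (∑ i ∈ s, f i) = ∏ i ∈ s, ψ (f i) := by
  classical
  induction s using Finset.induction_on with
  | empty => simp
  | insert i s hi ih => rw [Finset.sum_insert hi, Finset.prod_insert hi, AddChar.map_add_eq_mul, ih]

theorem frobenius_invariant_iterate {K : Type*} [Field K] {p : ℕ} {ψ : AddChar K ℂ}
    (hψ : ∀ x, ψ (x ^ p) = ψ x) (k : ℕ) (x : K) :
    ψ (x ^ p ^ k) = ψ x := by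
  induction k generalizing x with
  | zero => simp
  | succ k ih => rw [pow_succ, pow_mul, hψ, ih]

/-! ### Frobenius-invariant characters and Weyl differencing -/

section FiniteField

variable {K : Type*} [Field K] [Fintype K] {p : ℕ} [Fact p.Prime] [CharP K p]

/-- Take the trace to the prime field followed by the standard character. Frobenius is a Galois
automorphism, so the trace does not see it, and surjectivity of the trace gives nontriviality. -/
theorem exists_frobenius_invariant_addChar (K : Type*) [Field K] [Fintype K] (p : ℕ)
    [Fact p.Prime] [CharP K p] :
    ∃ ψ : AddChar K ℂ, ψ.IsPrimitive ∧ ∀ x, ψ (x ^ p) = ψ x := by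
  let _ : Algebra (ZMod p) K := ZMod.algebra K p
  let e : AddChar (ZMod p) ℂ := ZMod.stdAddChar
  refine ⟨e.compAddMonoidHom (Algebra.trace (ZMod p) K).toAddMonoidHom,
    AddChar.IsPrimitive.of_ne_one ?_, fun x => ?_⟩
  · rw [AddChar.ne_one_iff]
    obtain ⟨x, hx⟩ := Algebra.trace_surjective (ZMod p) K 1
    refine ⟨x, fun h => ?_⟩
    have h0 : e 1 = 1 := by simpa [hx] using h
    have : (1 : ZMod p) = 0 := ZMod.injective_stdAddChar (by simpa using h0)
    exact one_ne_zero this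
  · have := Algebra.trace_eq_of_algEquiv (FiniteField.frobeniusAlgEquivOfAlgebraic (ZMod p) K) x
    simp only [AddChar.compAddMonoidHom_apply]
    congr 1
    simpa [ZMod.card] using this

variable (p) in
/-- The coefficient of `y ^ r` in the polynomial with exponents prime to `p` that has the same
Frobenius-invariant character values as `G`. -/
def collapse (D : ℕ) (G : K[X]) (r : ℕ) : K :=
  ∑ j ∈ (Finset.Icc 1 D).filter fun j => ordCompl[p] j = r,
    (iterateFrobeniusEquiv K p (j.factorization p)).symm (G.coeff j)

/-- By invariance `ψ(g y^(r p^k)) = ψ(g^(1/p^k) y^r)`, the root existing because `K` is perfect.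
Grouping the exponents by their part `r` prime to `p` gives the collapsed coefficients. -/
theorem addChar_eval_eq {ψ : AddChar K ℂ} (hψ : ∀ x, ψ (x ^ p) = ψ x) {D : ℕ} {G : K[X]}
    (hG : G.natDegree ≤ D) (y : K) :
    ψ (G.eval y) =
      ψ (G.coeff 0) * ψ (∑ r ∈ coprimeExponents p D, collapse p D G r * y ^ r) := by
  have hp : p.Prime := Fact.out
  have h1 : G.eval y = G.coeff 0 + ∑ j ∈ Finset.Icc 1 D, G.coeff j * y ^ j := by
    rw [eval_eq_sum_range' (Nat.lt_succ_of_le hG), Finset.range_eq_Ico,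
      Finset.sum_eq_sum_Ico_succ_bot (Nat.succ_pos D)]
    simp
    rfl
  have h2 : ∑ r ∈ coprimeExponents p D, collapse p D G r * y ^ r =
      ∑ j ∈ Finset.Icc 1 D,
        (iterateFrobeniusEquiv K p (j.factorization p)).symm (G.coeff j) * y ^ (ordCompl[p] j) := by
    rw [← Finset.sum_fiberwise_of_maps_to (s := Finset.Icc 1 D) (t := coprimeExponents p D)
      (g := fun j => ordCompl[p] j) fun j hj => ordCompl_mem_coprimeExponents hp hj]
    refine Finset.sum_congr rfl fun r _ => ?_
    rw [collapse, Finset.sum_mul]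
    refine Finset.sum_congr rfl fun j hj => ?_
    rw [(Finset.mem_filter.1 hj).2]
  rw [h1, h2, AddChar.map_add_eq_mul, addChar_map_sum, addChar_map_sum]
  congr 1
  refine Finset.prod_congr rfl fun j _ => ?_
  rw [← frobenius_invariant_iterate hψ (j.factorization p)
    ((iterateFrobeniusEquiv K p (j.factorization p)).symm (G.coeff j) * _), mul_pow, ← pow_mul,
    mul_comm (ordCompl[p] j), Nat.ordProj_mul_ordCompl_eq_self]
  congr 2
  have := (iterateFrobeniusEquiv K p (j.factorization p)).apply_symm_apply (G.coeff j)
  rw [iterateFrobeniusEquiv_apply, iterateFrobenius_def] at this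
  exact this.symm

/-- If `G` has degree `D + 1` prime to `p`, then for most `h` the polynomial `G(y + h) - G(y)` has
a nonzero collapsed coefficient. -/
theorem card_collapse_eq_zero_le {D : ℕ} (hD : 1 ≤ D) {G : K[X]} (hG : G.natDegree ≤ D + 1)
    (hp : ¬ p ∣ D + 1) (hc : G.coeff (D + 1) ≠ 0) :
    ∃ bad : Finset K, bad.card ≤ D * D ∧
      ∀ h ∉ bad, collapse p D (taylor h G - G) (ordCompl[p] D) ≠ 0 := by
  classical
  have hprime : p.Prime := Fact.out
  set r := ordCompl[p] D with hr
  set k := D.factorization p with hk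
  have hrpos : 0 < r := Nat.ordCompl_pos p (by omega)
  set S := (Finset.Icc 1 D).filter fun j => ordCompl[p] j = r with hS
  have hj : ∀ j ∈ S, j = p ^ j.factorization p * r := fun j hj => by
    rw [← (Finset.mem_filter.1 hj).2, Nat.ordProj_mul_ordCompl_eq_self]
  have hDS : D = p ^ k * r := (Nat.ordProj_mul_ordCompl_eq_self D p).symm
  have hle : ∀ j ∈ S, j.factorization p ≤ k := fun j hj' => by
    have h1 : j ≤ D := (Finset.mem_Icc.1 (Finset.mem_filter.1 hj').1).2
    rw [hj j hj', hDS] at h1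
    exact (Nat.pow_le_pow_iff_right hprime.one_lt).1 (Nat.le_of_mul_le_mul_right h1 hrpos)
  -- The `p^k`-th power of the collapsed coefficient, as a polynomial in `h`; the power clears all
  -- the roots, since `k` is the largest exponent occurring in `S`. Every term except `j = D` is a
  -- `p`-th power, so only that term contributes to the derivative. As `p ∤ D + 1`, this shows `T ≠
  -- 0`, and the roots of `T` are the bad `h`.
  set T : K[X] := ∑ j ∈ S, differenceCoeff G j ^ p ^ (k - j.factorization p) with hT
  have hDmem : D ∈ S := Finset.mem_filter.2 ⟨Finset.mem_Icc.2 ⟨hD, le_rfl⟩, rfl⟩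
  have hdT : derivative T = C ((D + 1) * G.coeff (D + 1)) := by
    rw [hT, derivative_sum, Finset.sum_eq_single_of_mem D hDmem, ← hk, Nat.sub_self, pow_zero,
      pow_one, derivative_differenceCoeff hG]
    intro j hjS hjD
    have hlt : j.factorization p < k := lt_of_le_of_ne (hle j hjS) fun h => hjD <| by
      rw [hj j hjS, h, ← hDS]
    rw [derivative_pow]
    have : ((p ^ (k - j.factorization p) : ℕ) : K) = 0 := by
      rw [Nat.cast_pow, CharP.cast_eq_zero, zero_pow (by omega)]
    rw [this]
    simp
  have hT0 : T ≠ 0 := fun h => by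
    rw [h, derivative_zero, eq_comm, C_eq_zero, mul_eq_zero] at hdT
    rcases hdT with h | h
    · exact hp ((CharP.cast_eq_zero_iff K p (D + 1)).1 (by exact_mod_cast h))
    · exact hc h
  have hdeg : T.natDegree ≤ D * D := by
    refine natDegree_sum_le_of_forall_le _ _ fun j hjS => natDegree_pow_le.trans ?_
    have h1 := natDegree_differenceCoeff_le G j
    have h2 := (Finset.mem_Icc.1 (Finset.mem_filter.1 hjS).1).1
    refine Nat.mul_le_mul ?_ (by omega)
    calc p ^ (k - j.factorization p) ≤ p ^ k :=
          Nat.pow_le_pow_right hprime.pos (Nat.sub_le _ _)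
      _ ≤ D := Nat.le_of_dvd (by omega) (Nat.ordProj_dvd D p)
  refine ⟨T.roots.toFinset, (Multiset.toFinset_card_le _).trans ((card_roots' T).trans hdeg),
    fun h hh h0 => hh ?_⟩
  rw [Multiset.mem_toFinset, mem_roots hT0, IsRoot.def]
  have h1 : (iterateFrobeniusEquiv K p k) (collapse p D (taylor h G - G) r) = 0 := by
    rw [h0, map_zero]
  rw [collapse, map_sum] at h1
  rw [← h1, hT, eval_finsetSum]
  refine Finset.sum_congr rfl fun j hjS => ?_
  rw [coeff_taylor_sub, eval_pow]
  obtain ⟨m, hm⟩ := Nat.exists_eq_add_of_le (hle j hjS)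
  have h2 := (iterateFrobeniusEquiv K p (j.factorization p)).apply_symm_apply
    ((differenceCoeff G j).eval h)
  rw [iterateFrobeniusEquiv_apply, iterateFrobenius_def] at h2
  rw [iterateFrobeniusEquiv_apply, iterateFrobenius_def, hm, Nat.add_sub_cancel_left, pow_add,
    pow_mul, h2]

/-- Weyl's induction on the degree: each differencing step squares the mean and so halves the
exponent of the saving. The differenced polynomial may involve exponents divisible by `p`, even in
its top degree; collapsing returns it to the shape of the induction hypothesis. -/
theorem norm_expect_addChar_sum_le {ψ : AddChar K ℂ} (hprim : ψ.IsPrimitive)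
    (hψ : ∀ x, ψ (x ^ p) = ψ x) (D : ℕ) (c : ℕ → K) (hc : ∃ r ∈ coprimeExponents p D, c r ≠ 0) :
    ‖𝔼 y, ψ (∑ r ∈ coprimeExponents p D, c r * y ^ r)‖ ≤
      (D + 1) * (Fintype.card K : ℝ) ^ (-(1 / 2 : ℝ) ^ D) := by
  induction D generalizing c with
  | zero =>
    obtain ⟨r, hr, -⟩ := hc
    have := pos_of_mem_coprimeExponents hr
    have := (mem_coprimeExponents.1 hr).1
    omega
  | succ D ih =>
    set q : ℝ := (Fintype.card K : ℝ) with hq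
    have hq1 : 1 ≤ q := by
      rw [hq]
      exact_mod_cast Fintype.card_pos
    set x : ℝ := q ^ (-(1 / 2 : ℝ) ^ (D + 1)) with hx
    have hx0 : 0 ≤ x := by positivity
    have hx2 : q ^ (-(1 / 2 : ℝ) ^ D) = x ^ 2 := by
      rw [hx, ← Real.rpow_mul_natCast (by linarith)]
      congr 1
      rw [pow_succ]
      push_cast
      ring
    have hx1 : x ≤ 1 := Real.rpow_le_one_of_one_le_of_nonpos hq1 (by simp)
    rw [hx2] at ih
    have hmono : ((D : ℝ) + 1) * x ^ 2 ≤ ((D + 1 : ℕ) + 1) * x := by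
      push_cast
      nlinarith [mul_nonneg hx0 (sub_nonneg.2 hx1), (Nat.cast_nonneg D : (0 : ℝ) ≤ D),
        mul_nonneg (Nat.cast_nonneg D : (0 : ℝ) ≤ D) (mul_nonneg hx0 (sub_nonneg.2 hx1))]
    by_cases hdvd : p ∣ D + 1
    · rw [coprimeExponents_succ_of_dvd hdvd] at hc ⊢
      exact (ih c hc).trans hmono
    by_cases hc0 : c (D + 1) = 0
    · rw [coprimeExponents_succ_of_not_dvd hdvd] at hc ⊢
      simp_rw [Finset.sum_insert succ_not_mem_coprimeExponents, hc0, zero_mul, zero_add]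
      obtain ⟨r, hr, hcr⟩ := hc
      rcases Finset.mem_insert.1 hr with rfl | hr
      · exact absurd hc0 hcr
      · exact (ih c ⟨r, hr, hcr⟩).trans hmono
    -- The linear case is plain orthogonality. It is separate because its differences are constant
    -- in `y` and leave nothing for the induction.
    rcases Nat.eq_zero_or_pos D with rfl | hD
    · have h1 : coprimeExponents p (0 + 1) = {1} := by
        rw [coprimeExponents_succ_of_not_dvd hdvd]
        ext r
        rw [Finset.mem_insert, Finset.mem_singleton, mem_coprimeExponents]
        constructor
        · rintro (h | ⟨h, h'⟩)
          · exact h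
          · exact absurd (by simp [Nat.le_zero.1 h] : p ∣ r) h'
        · exact Or.inl
      have h2 := AddChar.expect_eq_zero_iff_ne_zero.2 (hprim hc0)
      simp only [AddChar.mulShift_apply, zero_add] at h2
      rw [h1]
      simp only [Finset.sum_singleton, pow_one, h2, norm_zero]
      positivity
    set G : K[X] := ∑ r ∈ coprimeExponents p (D + 1), C (c r) * X ^ r with hG
    have hGdeg : G.natDegree ≤ D + 1 := natDegree_sum_le_of_forall_le _ _ fun r hr =>
      (natDegree_C_mul_X_pow_le _ _).trans (mem_coprimeExponents.1 hr).1
    have hGc : G.coeff (D + 1) = c (D + 1) := by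
      rw [hG, finsetSum_coeff]
      simp_rw [coeff_C_mul_X_pow]
      rw [Finset.sum_ite_eq, if_pos (mem_coprimeExponents.2 ⟨le_rfl, hdvd⟩)]
    have hGe : ∀ y, ∑ r ∈ coprimeExponents p (D + 1), c r * y ^ r = G.eval y := fun y => by
      simp [hG, eval_finsetSum]
    simp_rw [hGe]
    obtain ⟨bad, hbad, hgood⟩ := card_collapse_eq_zero_le hD hGdeg hdvd (hGc ▸ hc0)
    have hdiff : ∀ h y, ψ (G.eval (y + h)) * conj (ψ (G.eval y)) =
        ψ ((taylor h G - G).eval y) := fun h y => by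
      rw [← AddChar.map_neg_eq_conj, ← AddChar.map_add_eq_mul, eval_sub, taylor_eval,
        sub_eq_add_neg]
    have hD' : ordCompl[p] D ∈ coprimeExponents p D :=
      ordCompl_mem_coprimeExponents Fact.out (Finset.mem_Icc.2 ⟨hD, le_rfl⟩)
    -- Exceptional shifts are bounded trivially and number at most `D²`; the others fall under the
    -- induction hypothesis. The step closes because `D² + (D + 1) ≤ (D + 2)²`.
    have hsq : ‖𝔼 y, ψ (G.eval y)‖ ^ 2 ≤ bad.card / q + (D + 1) * x ^ 2 := by
      refine (norm_expect_sq_le _).trans (expect_le_card_div_add _ bad (by positivity) ?_ ?_)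
      · exact fun h => norm_expect_le_one _ fun y => by rw [hdiff, AddChar.norm_apply]
      · intro h hh
        simp_rw [hdiff, addChar_eval_eq hψ (natDegree_taylor_sub_le hGdeg h)]
        rw [← Finset.mul_expect, norm_mul, AddChar.norm_apply, one_mul]
        exact ih _ ⟨_, hD', hgood h hh⟩
    have hinv : 1 / q ≤ x ^ 2 := by
      rw [← hx2, one_div, ← Real.rpow_neg_one]
      exact Real.rpow_le_rpow_of_exponent_le hq1
        (neg_le_neg (pow_le_one₀ (by norm_num) (by norm_num)))
    have hb : (bad.card : ℝ) / q ≤ D * D * x ^ 2 := by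
      rw [div_eq_mul_one_div]
      exact mul_le_mul (by exact_mod_cast hbad) hinv (by positivity) (by positivity)
    refine (sq_le_sq₀ (norm_nonneg _) (by positivity)).1 ?_
    push_cast
    nlinarith [sq_nonneg x, mul_nonneg (Nat.cast_nonneg D : (0 : ℝ) ≤ D) (sq_nonneg x)]

end FiniteField

/-! ### Exponential sums over a finite commutative ring -/

section FiniteField

variable {K : Type*} [Field K] [Fintype K] {p : ℕ} [Fact p.Prime] [CharP K p]

/-- Primitivity makes `c ↦ ψ.mulShift c` injective, and a finite group has as many characters as
elements. -/
theorem exists_eq_mulShift {ψ : AddChar K ℂ} (hψ : ψ.IsPrimitive) (θ : AddChar K ℂ) :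
    ∃ c, θ = ψ.mulShift c := by
  have h := ((Fintype.bijective_iff_injective_and_card ψ.mulShift).2
    ⟨AddChar.to_mulShift_inj_of_isPrimitive hψ, AddChar.card_eq.symm⟩).2 θ
  obtain ⟨c, rfl⟩ := h
  exact ⟨c, rfl⟩

theorem exists_addChar_coefficients (θ : ℕ → AddChar K ℂ) :
    ∃ (ψ : AddChar K ℂ) (c : ℕ → K), ψ.IsPrimitive ∧ (∀ x, ψ (x ^ p) = ψ x) ∧
      (∀ r x, θ r x = ψ (c r * x)) ∧ ∀ r, θ r ≠ 1 → c r ≠ 0 := by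
  obtain ⟨ψ, hprim, hψ⟩ := exists_frobenius_invariant_addChar K p
  choose c hc using fun r => exists_eq_mulShift hprim (θ r)
  refine ⟨ψ, c, hprim, hψ, fun r x => by rw [hc r, AddChar.mulShift_apply], fun r hr h => hr ?_⟩
  rw [hc r, h, AddChar.mulShift_zero]

theorem norm_expect_prod_addChar_le (D : ℕ) (θ : ℕ → AddChar K ℂ)
    (hθ : ∃ r ∈ coprimeExponents p D, θ r ≠ 1) :
    ‖𝔼 y, ∏ r ∈ coprimeExponents p D, θ r (y ^ r)‖ ≤
      (D + 1) * (Fintype.card K : ℝ) ^ (-(1 / 2 : ℝ) ^ D) := by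
  obtain ⟨ψ, c, hprim, hψ, hc, hc0⟩ := exists_addChar_coefficients (p := p) θ
  simp_rw [hc, ← addChar_map_sum]
  obtain ⟨r, hr, h⟩ := hθ
  exact norm_expect_addChar_sum_le hprim hψ D c ⟨r, hr, hc0 r h⟩

/-- The inner sum is a linear character sum with frequency `G'(u)`, so it vanishes unless `u` is a
root of `G'`. Exponents prime to `p` keep `G'` nonzero, hence there are few roots. This serves the
nilpotent case over a ring. -/
theorem expect_norm_expect_linear_le (D : ℕ) (θ : ℕ → AddChar K ℂ)
    (hθ : ∃ r ∈ coprimeExponents p D, θ r ≠ 1) :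
    𝔼 u, ‖𝔼 v, ∏ r ∈ coprimeExponents p D, θ r (r * u ^ (r - 1) * v)‖ ≤
      (D + 1) * (Fintype.card K : ℝ) ^ (-(1 / 2 : ℝ) ^ D) := by
  classical
  obtain ⟨ψ, c, hprim, -, hc, hc0⟩ := exists_addChar_coefficients (p := p) θ
  obtain ⟨r, hr, h⟩ := hθ
  set G : K[X] := ∑ r ∈ coprimeExponents p D, C (c r) * X ^ r with hG
  have hGc : G.coeff r = c r := by
    rw [hG, finsetSum_coeff]
    simp_rw [coeff_C_mul_X_pow]
    rw [Finset.sum_ite_eq, if_pos hr]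
  have hGdeg : G.natDegree ≤ D := natDegree_sum_le_of_forall_le _ _ fun r hr =>
    (natDegree_C_mul_X_pow_le _ _).trans (mem_coprimeExponents.1 hr).1
  have hd : derivative G ≠ 0 := fun h0 => by
    have h1 := coeff_derivative G (r - 1)
    have hrpos := pos_of_mem_coprimeExponents hr
    rw [h0, coeff_zero, Nat.sub_add_cancel hrpos, hGc, eq_comm, mul_eq_zero] at h1
    rcases h1 with h1 | h1
    · exact hc0 r h h1
    · refine (mem_coprimeExponents.1 hr).2 ((CharP.cast_eq_zero_iff K p r).1 ?_)
      rw [← Nat.sub_add_cancel hrpos]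
      exact_mod_cast h1
  have hsum : ∀ u v, ∏ r ∈ coprimeExponents p D, θ r (r * u ^ (r - 1) * v) =
      ψ.mulShift ((derivative G).eval u) v := fun u v => by
    simp_rw [hc, ← addChar_map_sum]
    rw [AddChar.mulShift_apply, hG, derivative_sum, eval_finsetSum, Finset.sum_mul]
    congr 1
    refine Finset.sum_congr rfl fun r _ => ?_
    rw [derivative_C_mul_X_pow, eval_mul, eval_C, eval_pow, eval_X]
    ring
  have hcard : (1 : ℝ) ≤ Fintype.card K := by exact_mod_cast Fintype.card_pos
  refine (expect_le_card_div_add _ (derivative G).roots.toFinset le_rfl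
    (fun u => norm_expect_le_one _ fun v => ?_) fun u hu => ?_).trans ?_
  · rw [hsum, AddChar.norm_apply]
  · simp_rw [hsum]
    rw [Multiset.mem_toFinset, mem_roots hd, IsRoot.def] at hu
    rw [AddChar.expect_eq_zero_iff_ne_zero.2 (hprim hu), norm_zero]
  · rw [add_zero, div_eq_mul_inv, ← Real.rpow_neg_one]
    have h1 : (derivative G).roots.toFinset.card ≤ D + 1 :=
      (Multiset.toFinset_card_le _).trans <| (card_roots' _).trans <|
        (natDegree_derivative_le G).trans (by omega)
    refine mul_le_mul (by exact_mod_cast h1) (Real.rpow_le_rpow_of_exponent_le hcard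
      (neg_le_neg (pow_le_one₀ (by norm_num) (by norm_num)))) (by positivity) (by positivity)

end FiniteField

/-! ### Reduction from a finite ring to a residue field -/

section FiniteRing

variable {R : Type*} [CommRing R]

/-- The largest ideal on which all the characters `χ r`, `r ∈ s`, are trivial. -/
def trivialIdeal (s : Finset ℕ) (χ : ℕ → AddChar R ℂ) : Ideal R where
  carrier := {a | ∀ r ∈ s, ∀ x, χ r (a * x) = 1}
  zero_mem' := fun r _ x => by simp
  add_mem' := fun {a b} ha hb r hr x => by
    rw [add_mul, AddChar.map_add_eq_mul, ha r hr, hb r hr, one_mul]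
  smul_mem' := fun c a ha r hr x => by
    rw [smul_eq_mul, mul_right_comm, mul_comm (c * x)]
    exact ha r hr _

theorem addChar_congr {s : Finset ℕ} {χ : ℕ → AddChar R ℂ} {a b : R}
    (h : a - b ∈ trivialIdeal s χ) {r : ℕ} (hr : r ∈ s) : χ r a = χ r b := by
  have h1 := h r hr 1
  rw [mul_one] at h1
  rw [← sub_add_cancel a b, AddChar.map_add_eq_mul, h1, one_mul]

/-- A proper ideal in a finite ring has an associated prime, which is maximal. -/
theorem exists_maximal_mul_mem [Finite R] {I : Ideal R} (hI : I ≠ ⊤) :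
    ∃ (a : R) (M : Ideal R), M.IsMaximal ∧ a ∉ I ∧ ∀ m ∈ M, a * m ∈ I := by
  have : Nontrivial (R ⧸ I) := Ideal.Quotient.nontrivial_iff.2 hI
  obtain ⟨M, hM⟩ := associatedPrimes.nonempty R (R ⧸ I)
  obtain ⟨hprime, x, hx⟩ := isAssociatedPrime_iff.1 hM
  obtain ⟨a, rfl⟩ := Ideal.Quotient.mk_surjective x
  have hmem : ∀ m, m ∈ M ↔ a * m ∈ I := fun m => by
    rw [hx, Submodule.mem_colon_singleton, Submodule.mem_bot, ← Ideal.Quotient.eq_zero_iff_mem,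
      mul_comm, map_mul]
    rfl
  refine ⟨a, M, IsArtinianRing.isMaximal_of_isPrime M, fun ha => hprime.ne_top ?_,
    fun m hm => (hmem m).1 hm⟩
  rw [Ideal.eq_top_iff_one, hmem, mul_one]
  exact ha

theorem expect_add_mul (f : R → ℂ) [Fintype R] (a : R) :
    𝔼 y, f y = 𝔼 u, 𝔼 v, f (u + a * v) := by
  rw [Finset.expect_comm]
  have : ∀ v, 𝔼 u, f (u + a * v) = 𝔼 y, f y := fun v =>
    Fintype.expect_equiv (Equiv.addRight (a * v)) _ _ fun _ => rfl
  simp_rw [this]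
  rw [Fintype.expect_const]

theorem expect_quotient {E : Type*} [AddCommGroup E] [Module ℚ≥0 E] [Fintype R] (M : Ideal R)
    [Fintype (R ⧸ M)] (g : R ⧸ M → E) :
    𝔼 v : R, g (Ideal.Quotient.mk M v) = 𝔼 x, g x := by
  have h1 : ∀ x : R ⧸ M, 𝔼 v : R, g (Ideal.Quotient.mk M v) =
      𝔼 v : R, g (Ideal.Quotient.mk M v + x) := fun x => by
    obtain ⟨w, rfl⟩ := Ideal.Quotient.mk_surjective x
    refine (Fintype.expect_equiv (Equiv.addRight w) _ _ fun v => ?_).symm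
    simp
  have h2 : ∀ v : R, 𝔼 x, g (Ideal.Quotient.mk M v + x) = 𝔼 x, g x := fun v =>
    Fintype.expect_equiv (Equiv.addLeft (Ideal.Quotient.mk M v)) _ _ fun _ => rfl
  calc 𝔼 v : R, g (Ideal.Quotient.mk M v)
      = 𝔼 _x : R ⧸ M, 𝔼 v : R, g (Ideal.Quotient.mk M v) := (Fintype.expect_const _).symm
    _ = 𝔼 x : R ⧸ M, 𝔼 v : R, g (Ideal.Quotient.mk M v + x) :=
        Finset.expect_congr rfl fun x _ => h1 x
    _ = 𝔼 x, g x := by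
        rw [Finset.expect_comm]
        simp_rw [h2]
        exact Fintype.expect_const _

theorem exists_addChar_quotient (M : Ideal R) (θ : AddChar R ℂ) (h : ∀ m ∈ M, θ m = 1) :
    ∃ θ' : AddChar (R ⧸ M) ℂ, ∀ v, θ' (Ideal.Quotient.mk M v) = θ v := by
  have hwd : ∀ a b : R, a - b ∈ M → θ a = θ b := fun a b hab => by
    rw [← sub_add_cancel a b, AddChar.map_add_eq_mul, h _ hab, one_mul]
  refine ⟨{ toFun := fun x => θ (Quotient.out x)
            map_zero_eq_one' := ?_
            map_add_eq_mul' := ?_ }, ?_⟩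
  · exact h _ (Ideal.Quotient.eq_zero_iff_mem.1 (Ideal.Quotient.mk_out _))
  · intro x y
    rw [← AddChar.map_add_eq_mul]
    refine hwd _ _ (Ideal.Quotient.eq.1 ?_)
    rw [map_add, Ideal.Quotient.mk_out, Ideal.Quotient.mk_out, Ideal.Quotient.mk_out]
  · intro v
    exact hwd _ _ (Ideal.Quotient.eq.1 (Ideal.Quotient.mk_out _))

theorem mul_pow_eq_of_mul_eq {S : Type*} [CommRing S] {e x y : S} (h : e * x = e * y) (n : ℕ) :
    e * x ^ n = e * y ^ n := by
  induction n with
  | zero => simp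
  | succ n ih =>
    calc e * x ^ (n + 1) = (e * x ^ n) * x := by ring
      _ = y ^ n * (e * x) := by rw [ih]; ring
      _ = _ := by rw [h]; ring

/-- Modulo `I`, the idempotent `e` splits the ring as a product, and `u + e v` has components `u`
and `u + v`. Powers are computed componentwise. -/
theorem pow_add_mul_sub_mem {I : Ideal R} {e : R} (he : e * e - e ∈ I) (u v : R) (r : ℕ) :
    (u + e * v) ^ r - ((1 - e) * u ^ r + e * (u + v) ^ r) ∈ I := by
  rw [← Ideal.Quotient.eq] at he ⊢
  simp only [map_add, map_mul, map_pow, map_sub, map_one] at he ⊢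
  set e' := Ideal.Quotient.mk I e
  set u' := Ideal.Quotient.mk I u
  set v' := Ideal.Quotient.mk I v
  have h1 : e' * (u' + e' * v') ^ r = e' * (u' + v') ^ r :=
    mul_pow_eq_of_mul_eq (by linear_combination v' * he) r
  have h2 : (1 - e') * (u' + e' * v') ^ r = (1 - e') * u' ^ r :=
    mul_pow_eq_of_mul_eq (by linear_combination -v' * he) r
  linear_combination h1 + h2

/-- Over a finite ring of characteristic `p`, a product of characters of powers prime to `p` has a
mean with a power saving in the size of some residue field. -/
theorem exists_maximal_norm_expect_le [Fintype R] {p : ℕ} [Fact p.Prime] (hp : (p : R) = 0)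
    (D : ℕ) (χ : ℕ → AddChar R ℂ) (hχ : ∃ r ∈ coprimeExponents p D, χ r ≠ 1) :
    ∃ M : Ideal R, M.IsMaximal ∧ ‖𝔼 y, ∏ r ∈ coprimeExponents p D, χ r (y ^ r)‖ ≤
      (D + 1) * (Nat.card (R ⧸ M) : ℝ) ^ (-(1 / 2 : ℝ) ^ D) := by
  classical
  set s := coprimeExponents p D with hs
  set I := trivialIdeal s χ with hI
  have hItop : I ≠ ⊤ := fun h => by
    obtain ⟨r, hr, h1⟩ := hχ
    refine h1 (AddChar.eq_one_iff.2 fun x => ?_)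
    have h2 : (1 : R) ∈ I := h ▸ Submodule.mem_top
    simpa using h2 r hr x
  obtain ⟨a, M, hM, haI, haM⟩ := exists_maximal_mul_mem hItop
  refine ⟨M, hM, ?_⟩
  let _ : Field (R ⧸ M) := Ideal.Quotient.field M
  let _ : Fintype (R ⧸ M) := Fintype.ofFinite _
  have hpK : ((p : ℕ) : R ⧸ M) = 0 := by
    have := congrArg (Ideal.Quotient.mk M) hp
    simpa using this
  have : CharP (R ⧸ M) p := (CharP.charP_iff_prime_eq_zero Fact.out).2 hpK
  rw [Nat.card_eq_fintype_card]
  -- Along such an `e` the characters descend to the residue field, and maximality of `I` among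
  -- trivial directions keeps one of them nontrivial.
  have key : ∀ e : R, e ∉ I → (∀ m ∈ M, e * m ∈ I) → ∃ θ : ℕ → AddChar (R ⧸ M) ℂ,
      (∃ r ∈ s, θ r ≠ 1) ∧ ∀ r ∈ s, ∀ v, χ r (e * v) = θ r (Ideal.Quotient.mk M v) := by
    intro e heI heM
    have h1 : ∀ r, ∃ θ : AddChar (R ⧸ M) ℂ, r ∈ s →
        ∀ v, χ r (e * v) = θ (Ideal.Quotient.mk M v) := fun r => by
      by_cases hr : r ∈ s
      · obtain ⟨θ, hθ⟩ := exists_addChar_quotient M ((χ r).mulShift e) fun m hm => by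
          have := heM m hm r hr 1
          rwa [mul_one] at this
        exact ⟨θ, fun _ v => (hθ v).symm⟩
      · exact ⟨1, fun h => absurd h hr⟩
    choose θ hθ using h1
    refine ⟨θ, ?_, hθ⟩
    by_contra! hcon
    refine heI fun r hr x => ?_
    rw [hθ r hr, hcon r hr, AddChar.one_apply]
  -- Nilpotent direction: the expansion of `(u + a v) ^ r` stops after the linear term modulo `I`.
  by_cases ha2 : a * a ∈ I
  · obtain ⟨θ, hθ1, hθ⟩ := key a haI haM
    have h1 : ∀ u v, ∏ r ∈ s, χ r ((u + a * v) ^ r) = (∏ r ∈ s, χ r (u ^ r)) *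
        ∏ r ∈ s, θ r (r * (Ideal.Quotient.mk M u) ^ (r - 1) * (Ideal.Quotient.mk M v)) := by
      intro u v
      rw [← Finset.prod_mul_distrib]
      refine Finset.prod_congr rfl fun r hr => ?_
      have h2 := hθ r hr (r * u ^ (r - 1) * v)
      simp only [map_mul, map_pow, map_natCast] at h2
      rw [← h2, ← AddChar.map_add_eq_mul]
      refine addChar_congr ?_ hr
      obtain ⟨k, hk⟩ := Polynomial.powAddExpansion u (a * v) r
      rw [hk]
      have : u ^ r + r * u ^ (r - 1) * (a * v) + k * (a * v) ^ 2 -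
          (u ^ r + a * (r * u ^ (r - 1) * v)) = (k * v ^ 2) * (a * a) := by ring
      rw [this]
      exact I.mul_mem_left _ ha2
    rw [expect_add_mul _ a]
    simp_rw [h1, ← Finset.mul_expect]
    refine (RCLike.norm_expect_le (K := ℝ)).trans ?_
    have h3 : ∀ u : R, ‖∏ r ∈ s, χ r (u ^ r)‖ = 1 := fun u => by
      rw [norm_prod]
      exact Finset.prod_eq_one fun r _ => AddChar.norm_apply _ _
    simp_rw [norm_mul, h3, one_mul]
    have h4 : ∀ u : R, 𝔼 v : R, ∏ r ∈ s, θ r (r * (Ideal.Quotient.mk M u) ^ (r - 1) *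
        (Ideal.Quotient.mk M v)) = 𝔼 v, ∏ r ∈ s, θ r (r * (Ideal.Quotient.mk M u) ^ (r - 1) * v) :=
      fun u => expect_quotient M fun v => ∏ r ∈ s, θ r (r * (Ideal.Quotient.mk M u) ^ (r - 1) * v)
    simp_rw [h4]
    rw [expect_quotient M fun u => ‖𝔼 v, ∏ r ∈ s, θ r (r * u ^ (r - 1) * v)‖]
    exact expect_norm_expect_linear_le D θ hθ1
  -- Here `a` is invertible modulo `M`. Multiplying it by an inverse gives an element idempotent
  -- modulo `I`, so the shift moves only a residue-field component.
  · have haM' : a ∉ M := fun h => ha2 (haM a h)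
    obtain ⟨b, i, hi, hbi⟩ := hM.exists_inv haM'
    set e := b * a with he
    have heM : ∀ m ∈ M, e * m ∈ I := fun m hm => by
      rw [he, mul_assoc]
      exact I.mul_mem_left _ (haM m hm)
    have heI : e ∉ I := fun h => haI <| by
      have h1 : a = a * e + a * i := by rw [← mul_add, hbi, mul_one]
      rw [h1]
      exact I.add_mem (I.mul_mem_left _ h) (haM i hi)
    have he2 : e * e - e ∈ I := by
      have h1 : e * e - e = -(e * i) := by linear_combination e * hbi
      rw [h1]
      exact I.neg_mem (heM i hi)
    obtain ⟨θ, hθ1, hθ⟩ := key e heI heM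
    have h1 : ∀ u v, ∏ r ∈ s, χ r ((u + e * v) ^ r) = (∏ r ∈ s, χ r ((1 - e) * u ^ r)) *
        ∏ r ∈ s, θ r ((Ideal.Quotient.mk M (u + v)) ^ r) := by
      intro u v
      rw [← Finset.prod_mul_distrib]
      refine Finset.prod_congr rfl fun r hr => ?_
      rw [← map_pow, ← hθ r hr, ← AddChar.map_add_eq_mul]
      exact addChar_congr (pow_add_mul_sub_mem he2 u v r) hr
    rw [expect_add_mul _ e]
    simp_rw [h1, ← Finset.mul_expect]
    refine (RCLike.norm_expect_le (K := ℝ)).trans ?_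
    have h3 : ∀ u : R, ‖∏ r ∈ s, χ r ((1 - e) * u ^ r)‖ = 1 := fun u => by
      rw [norm_prod]
      exact Finset.prod_eq_one fun r _ => AddChar.norm_apply _ _
    have h4 : ∀ u : R, 𝔼 v : R, ∏ r ∈ s, θ r ((Ideal.Quotient.mk M (u + v)) ^ r) =
        𝔼 x, ∏ r ∈ s, θ r (x ^ r) := fun u => by
      rw [← expect_quotient M fun x => ∏ r ∈ s, θ r (x ^ r)]
      exact Fintype.expect_equiv (Equiv.addLeft u) _ _ fun _ => rfl
    simp_rw [norm_mul, h3, one_mul, h4]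
    rw [Fintype.expect_const]
    exact norm_expect_prod_addChar_le D θ hθ1

end FiniteRing

/-! ### Characters of `𝔽[t]_Q` at polynomial values -/

section PowerChar

variable {R : Type*} [CommRing R] {p : ℕ} [Fact p.Prime] [CharP R p]

variable (p) in
/-- The character `x ↦ ∏ χ (b j * x ^ p ^ k)`, the product being over the `j = r p ^ k ≤ D`. -/
def powerChar (χ : AddChar R ℂ) (b : ℕ → R) (D r : ℕ) : AddChar R ℂ :=
  ∏ j ∈ (Finset.Icc 1 D).filter fun j => ordCompl[p] j = r,
    χ.compAddMonoidHom ((AddMonoidHom.mulLeft (b j)).comp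
      (iterateFrobenius R p (j.factorization p)).toAddMonoidHom)

/-- Frobenius need not be bijective on `R`, so no roots of coefficients are taken. Its powers are
instead absorbed into the characters, which therefore differ from one `r` to another. -/
theorem addChar_sum_pow_eq (χ : AddChar R ℂ) (b : ℕ → R) (D : ℕ) (y : R) :
    χ (∑ j ∈ Finset.Icc 1 D, b j * y ^ j) =
      ∏ r ∈ coprimeExponents p D, powerChar p χ b D r (y ^ r) := by
  rw [addChar_map_sum, ← Finset.prod_fiberwise_of_maps_to (s := Finset.Icc 1 D)
    (t := coprimeExponents p D) (g := fun j => ordCompl[p] j)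
    fun j hj => ordCompl_mem_coprimeExponents Fact.out hj]
  refine Finset.prod_congr rfl fun r _ => ?_
  rw [powerChar, AddChar.prod_apply]
  refine Finset.prod_congr rfl fun j hj => ?_
  have h : y ^ j = (y ^ r) ^ p ^ j.factorization p := by
    rw [← (Finset.mem_filter.1 hj).2, ← pow_mul, mul_comm, Nat.ordProj_mul_ordCompl_eq_self]
  rw [h]
  simp [iterateFrobenius_def]

end PowerChar

section QuotRing

variable {F : Type*} [Field F] [Fintype F]


theorem card_quotRing (Q : MonicPoly F) :
    (Fintype.card (QuotRing Q) : ℤ) = cardPowDegree Q.1 := by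
  have : Module.Finite F (F[X] ⧸ Ideal.span {Q.1}) := Q.2.finite_quotient
  rw [cardPowDegree_nonzero _ Q.2.ne_zero, ← finrank_quotient_span_eq_natDegree (f := Q.1),
    ← Nat.card_eq_fintype_card, Module.natCard_eq_pow_finrank (K := F), Nat.card_eq_fintype_card]
  push_cast
  rfl

theorem lpf_le_of_dvd {Q : MonicPoly F} {R : F[X]} (hm : R.Monic) (hi : Irreducible R)
    (hd : R ∣ Q.1) : lpf Q ≤ cardPowDegree R :=
  csInf_le ⟨0, by rintro _ ⟨R, -, -, -, rfl⟩; exact AbsoluteValue.nonneg _ _⟩ ⟨R, hm, hi, hd, rfl⟩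

/-- The kernel of `𝔽[t] → 𝔽[t]_Q / M` is generated by a monic irreducible factor `π` of `Q`, and the
residue field has `|π|` elements. -/
theorem lpf_le_card_quotient {Q : MonicPoly F} (M : Ideal (QuotRing Q)) (hM : M.IsMaximal) :
    (lpf Q : ℝ) ≤ Nat.card (QuotRing Q ⧸ M) := by
  classical
  let φ : F[X] →+* QuotRing Q ⧸ M := (Ideal.Quotient.mk M).comp (Ideal.Quotient.mk _)
  have hφ : Function.Surjective φ :=
    Ideal.Quotient.mk_surjective.comp Ideal.Quotient.mk_surjective
  let _ : Field (QuotRing Q ⧸ M) := Ideal.Quotient.field M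
  have hmax : (RingHom.ker φ).IsMaximal := RingHom.ker_isMaximal_of_surjective φ hφ
  have hQ : Q.1 ∈ RingHom.ker φ := by
    rw [RingHom.mem_ker, RingHom.comp_apply,
      Ideal.Quotient.eq_zero_iff_mem.2 (Ideal.mem_span_singleton_self Q.1), map_zero]
  obtain ⟨g, hg⟩ := IsPrincipalIdealRing.principal (RingHom.ker φ)
  have hg0 : g ≠ 0 := by
    rintro rfl
    rw [hg] at hQ
    exact Q.2.ne_zero (by simpa using hQ)
  set π := normalize g with hπ
  have hspan : RingHom.ker φ = Ideal.span {π} := by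
    rw [hg]
    exact (Ideal.span_singleton_eq_span_singleton.2 (normalize_associated g)).symm
  have hπ0 : π ≠ 0 := by rwa [hπ, Ne, normalize_eq_zero]
  have hprime : Prime π := by
    rw [← Ideal.span_singleton_prime hπ0, ← hspan]
    exact hmax.isPrime
  have hle : lpf Q ≤ cardPowDegree π := lpf_le_of_dvd
    (Polynomial.monic_normalize hg0) hprime.irreducible
    (Ideal.mem_span_singleton.1 (hspan ▸ hQ))
  obtain ⟨π', hπ'⟩ : ∃ π' : MonicPoly F, π'.1 = π := ⟨⟨π, Polynomial.monic_normalize hg0⟩, rfl⟩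
  rw [← hπ'] at hspan hle
  have hcard : Nat.card (QuotRing Q ⧸ M) = Fintype.card (QuotRing π') := by
    rw [← Nat.card_eq_fintype_card]
    refine Nat.card_congr ((RingHom.quotientKerEquivOfSurjective hφ).symm.trans
      (Ideal.quotEquivOfEq hspan)).toEquiv
  rw [hcard]
  have := card_quotRing π'
  exact_mod_cast this ▸ hle

theorem aeval_quotRing {F : Type*} [Field F] (P : F[X][X]) (Q : MonicPoly F) (y : F[X]) :
    aeval (Ideal.Quotient.mk (Ideal.span {Q.1}) y) P = Ideal.Quotient.mk _ (P.eval y) :=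
  aeval_algebraMap_apply_eq_algebraMap_eval y P

/-- The kernel of `χ` pulled back to `𝔽[t]` is a subgroup containing both `H` and `Q𝔽[t]`. -/
theorem addChar_eq_one_of_trivial {F : Type*} [Field F] {P : F[X][X]} {Q : MonicPoly F}
    (hH : valueGroup P ⊔ (Ideal.span {Q.1}).toAddSubgroup = ⊤) {χ : AddChar (QuotRing Q) ℂ}
    (h : ∀ y, χ (aeval y P) = χ (aeval 0 P)) : χ = 1 := by
  let N : AddSubgroup F[X] := (χ.compAddMonoidHom
    (Ideal.Quotient.mk (Ideal.span {Q.1})).toAddMonoidHom).toAddMonoidHom.ker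
  have hN : ∀ x, x ∈ N ↔ χ (Ideal.Quotient.mk _ x) = 1 := fun x => Iff.rfl
  have h1 : valueGroup P ⊔ (Ideal.span {Q.1}).toAddSubgroup ≤ N := by
    refine sup_le ((AddSubgroup.closure_le _).2 ?_) fun x hx => ?_
    · rintro _ ⟨y, rfl⟩
      refine (hN _).2 ?_
      rw [map_sub, ← aeval_quotRing, ← aeval_quotRing, AddChar.map_sub_eq_div, h, map_zero]
      exact div_self ((AddChar.val_isUnit _ _).ne_zero)
    · rw [hN, Ideal.Quotient.eq_zero_iff_mem.2 hx, AddChar.map_zero_eq_one]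
  rw [hH] at h1
  refine AddChar.eq_one_iff.2 fun x => ?_
  obtain ⟨x, rfl⟩ := Ideal.Quotient.mk_surjective x
  exact (hN x).1 (h1 (AddSubgroup.mem_top x))

theorem norm_expect_addChar_aeval_le {P : F[X][X]} {Q : MonicPoly F} (hlpf : 0 < lpf Q)
    (hH : valueGroup P ⊔ (Ideal.span {Q.1}).toAddSubgroup = ⊤) {χ : AddChar (QuotRing Q) ℂ}
    (hχ : χ ≠ 1) :
    ‖𝔼 y, χ (aeval y P)‖ ≤
      (P.natDegree + 1) * (lpf Q : ℝ) ^ (-(1 / 2 : ℝ) ^ P.natDegree) := by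
  obtain ⟨p, hp⟩ := CharP.exists F
  have : Fact p.Prime := ⟨CharP.char_is_prime F p⟩
  have : Nontrivial (QuotRing Q) := by
    by_contra hcon
    rw [not_nontrivial_iff_subsingleton] at hcon
    exact hχ (AddChar.eq_one_iff.2 fun x => by
      rw [Subsingleton.elim x 0, AddChar.map_zero_eq_one])
  have : CharP (QuotRing Q) p := charP_of_injective_algebraMap
    (algebraMap F (QuotRing Q)).injective p
  set D := P.natDegree with hD
  set b : ℕ → QuotRing Q := fun j => algebraMap F[X] (QuotRing Q) (P.coeff j) with hb
  have h1 : ∀ y : QuotRing Q, aeval y P = b 0 + ∑ j ∈ Finset.Icc 1 D, b j * y ^ j := fun y => by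
    rw [aeval_eq_sum_range, Finset.range_eq_Ico,
      Finset.sum_eq_sum_Ico_succ_bot (Nat.succ_pos D)]
    simp only [Algebra.smul_def, pow_zero, mul_one, hb]
    rfl
  have h2 : ∀ y : QuotRing Q, χ (aeval y P) =
      χ (b 0) * ∏ r ∈ coprimeExponents p D, powerChar p χ b D r (y ^ r) := fun y => by
    rw [h1, AddChar.map_add_eq_mul, addChar_sum_pow_eq]
  -- If all these characters were trivial, `χ(P(y))` would be constant in `y`, which the hypothesis
  -- on `H` excludes.
  have h3 : ∃ r ∈ coprimeExponents p D, powerChar p χ b D r ≠ 1 := by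
    by_contra! hcon
    refine hχ (addChar_eq_one_of_trivial hH fun y => ?_)
    rw [h2, h2, Finset.prod_congr rfl fun r hr => by rw [hcon r hr, AddChar.one_apply],
      eq_comm, Finset.prod_congr rfl fun r hr => by rw [hcon r hr, AddChar.one_apply]]
  obtain ⟨M, hM, hle⟩ := exists_maximal_norm_expect_le (CharP.cast_eq_zero (QuotRing Q) p) D _ h3
  simp_rw [h2]
  rw [← Finset.mul_expect, norm_mul, AddChar.norm_apply, one_mul]
  refine hle.trans (mul_le_mul_of_nonneg_left ?_ (by positivity))
  exact Real.rpow_le_rpow_of_nonpos (by exact_mod_cast hlpf) (lpf_le_card_quotient M hM) (by simp)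

end QuotRing

/-! ### The `L²` norm of the discrepancy -/

section Fourier

theorem l2Norm_sq {S : Type*} [Fintype S] (f : S → ℂ) : l2Norm f ^ 2 = 𝔼 x, ‖f x‖ ^ 2 :=
  Real.sq_sqrt (Finset.expect_nonneg fun _ _ => by positivity)

theorem l2Norm_nonneg {S : Type*} [Fintype S] (f : S → ℂ) : 0 ≤ l2Norm f := Real.sqrt_nonneg _

theorem l2Norm_smul {S : Type*} [Fintype S] (a : ℂ) (f : S → ℂ) :
    l2Norm (fun x => a * f x) = ‖a‖ * l2Norm f := by
  refine (sq_eq_sq₀ (l2Norm_nonneg _) (mul_nonneg (norm_nonneg _) (l2Norm_nonneg _))).1 ?_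
  rw [mul_pow, l2Norm_sq, l2Norm_sq, Finset.mul_expect]
  simp [mul_pow]

/-- Parseval's identity. -/
theorem l2Norm_sum_addChar_sq {G : Type*} [AddCommGroup G] [Fintype G]
    (c : AddChar G ℂ → ℂ) : l2Norm (fun x => ∑ ψ, c ψ * ψ x) ^ 2 = ∑ ψ, ‖c ψ‖ ^ 2 := by
  classical
  have horth : ∀ ψ φ : AddChar G ℂ, 𝔼 x, ψ x * conj (φ x) = if ψ = φ then 1 else 0 := by
    intro ψ φ
    have h := AddChar.expect_eq_ite (ψ - φ)
    simp only [sub_eq_zero] at h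
    rw [← h]
    refine Finset.expect_congr rfl fun x _ => ?_
    rw [AddChar.sub_apply, AddChar.map_neg_eq_conj]
  have h1 : ∀ z : ℂ, ((‖z‖ ^ 2 : ℝ) : ℂ) = z * conj z := fun z => by
    rw [Complex.mul_conj, Complex.normSq_eq_norm_sq]
  have h2 : (((𝔼 x, ‖∑ ψ, c ψ * ψ x‖ ^ 2 : ℝ)) : ℂ) = ((∑ ψ, ‖c ψ‖ ^ 2 : ℝ) : ℂ) := by
    have h3 : (((𝔼 x, ‖∑ ψ, c ψ * ψ x‖ ^ 2 : ℝ)) : ℂ) =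
        𝔼 x, (∑ ψ, c ψ * ψ x) * conj (∑ ψ, c ψ * ψ x) := by
      simp_rw [← h1]
      simp [Fintype.expect_eq_sum_div_card]
    rw [h3, Complex.ofReal_sum]
    simp_rw [h1, map_sum, map_mul, Finset.sum_mul_sum]
    rw [Finset.expect_sum_comm]
    refine Finset.sum_congr rfl fun ψ _ => ?_
    rw [Finset.expect_sum_comm]
    have h4 : ∀ φ : AddChar G ℂ, 𝔼 x, c ψ * ψ x * (conj (c φ) * conj (φ x)) =
        c ψ * conj (c φ) * if ψ = φ then 1 else 0 := fun φ => by
      rw [← horth, Finset.mul_expect]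
      exact Finset.expect_congr rfl fun x _ => by ring
    simp_rw [h4]
    simp
  rw [l2Norm_sq]
  exact_mod_cast h2

variable {F : Type*} [Field F] [Fintype F]

/-- The map `f ↦ discrepancy P Q f` is a Fourier multiplier, so Parseval reduces its norm to its
symbol `m`. The symbol vanishes at the trivial character, where the two averages cancel. -/
theorem l2Norm_discrepancy_le_mul {P : F[X][X]} {Q : MonicPoly F} {B : ℝ}
    (h : ∀ χ : AddChar (QuotRing Q) ℂ, χ ≠ 1 → ‖𝔼 y, χ (aeval y P)‖ ≤ B) (hB : 0 ≤ B)
    (f : QuotRing Q → ℂ) : l2Norm (discrepancy P Q f) ≤ B * l2Norm f := by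
  classical
  set c : AddChar (QuotRing Q) ℂ → ℂ := fun ψ => (AddChar.complexBasis (QuotRing Q)).repr f ψ
  have hf : f = fun x => ∑ ψ, c ψ * ψ x := by
    funext x
    have := congrFun ((AddChar.complexBasis (QuotRing Q)).sum_repr f) x
    rw [← this]
    simp [c, Finset.sum_apply]
  set m : AddChar (QuotRing Q) ℂ → ℂ := fun ψ => (𝔼 y, ψ (aeval y P)) - 𝔼 z, ψ z with hm
  have hmB : ∀ ψ, ‖m ψ‖ ≤ B := fun ψ => by
    by_cases hψ : ψ = 1
    · simpa [hm, hψ] using hB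
    · have h0 : 𝔼 z, ψ z = 0 := AddChar.expect_eq_zero_iff_ne_zero.2 hψ
      rw [hm]
      simpa only [h0, sub_zero] using h ψ hψ
  have hd : discrepancy P Q f = fun x => ∑ ψ, (c ψ * m ψ) * ψ x := by
    funext x
    rw [discrepancy, hf]
    simp only
    rw [Finset.expect_sum_comm, Finset.expect_sum_comm, ← Finset.sum_sub_distrib]
    refine Finset.sum_congr rfl fun ψ _ => ?_
    simp only [AddChar.map_add_eq_mul, ← Finset.mul_expect]
    by_cases hψ : ψ = 1
    · simp [hm, hψ]
    · have h0 : 𝔼 z, ψ z = 0 := AddChar.expect_eq_zero_iff_ne_zero.2 hψ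
      simp only [hm, h0]
      ring
  refine (sq_le_sq₀ (l2Norm_nonneg _) (mul_nonneg hB (l2Norm_nonneg _))).1 ?_
  rw [mul_pow, hd, l2Norm_sum_addChar_sq]
  conv_rhs => rw [hf, l2Norm_sum_addChar_sq]
  rw [Finset.mul_sum]
  refine Finset.sum_le_sum fun ψ _ => ?_
  rw [norm_mul, mul_pow, mul_comm]
  have := hmB ψ
  gcongr

theorem supDiscrepancy_le {P : F[X][X]} {Q : MonicPoly F} {B : ℝ}
    (h : ∀ χ : AddChar (QuotRing Q) ℂ, χ ≠ 1 → ‖𝔼 y, χ (aeval y P)‖ ≤ B) (hB : 0 ≤ B) :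
    supDiscrepancy P Q ≤ B :=
  ciSup_le fun f => (l2Norm_discrepancy_le_mul h hB f.1).trans (by rw [f.2, mul_one])

theorem l2Norm_discrepancy_le (P : F[X][X]) (Q : MonicPoly F) (f : QuotRing Q → ℂ) :
    l2Norm (discrepancy P Q f) ≤ supDiscrepancy P Q * l2Norm f := by
  rcases (l2Norm_nonneg f).eq_or_lt with h0 | h0
  · have hf : f = 0 := by
      have h1 := l2Norm_sq f
      rw [← h0, eq_comm, zero_pow two_ne_zero,
        Finset.expect_eq_zero_iff_of_nonneg (fun _ _ => by positivity)] at h1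
      funext x
      simpa using h1 x (Finset.mem_univ x)
    rw [← h0, mul_zero, hf]
    simp [l2Norm, discrepancy]
  · set a : ℂ := (((l2Norm f)⁻¹ : ℝ) : ℂ) with ha
    have hna : ‖a‖ = (l2Norm f)⁻¹ := by
      rw [ha, Complex.norm_real, Real.norm_of_nonneg (inv_nonneg.2 h0.le)]
    have h1 : l2Norm (fun x => a * f x) = 1 := by
      rw [l2Norm_smul, hna, inv_mul_cancel₀ h0.ne']
    have h2 := le_ciSup (bddAbove_discrepancy P Q) ⟨_, h1⟩
    have h3 : discrepancy P Q (fun x => a * f x) = fun x => a * discrepancy P Q f x := by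
      funext x
      simp only [discrepancy, ← Finset.mul_expect, mul_sub]
    simp only [h3, l2Norm_smul, hna] at h2
    rwa [inv_mul_le_iff₀ h0, mul_comm] at h2

end Fourier

/-! ### The implications between the five properties -/

section Functional

/-- Over the prime field every subgroup is a subspace, and a proper subspace lies in the kernel of a
nonzero functional. -/
theorem exists_zmod_functional_of_module {V : Type*} [AddCommGroup V] {p : ℕ} [Fact p.Prime]
    [Module (ZMod p) V]
    {S : AddSubgroup V} (hS : S ≠ ⊤) :
    ∃ φ : V →+ ZMod p, φ ≠ 0 ∧ ∀ v ∈ S, φ v = 0 := by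
  let T : Submodule (ZMod p) V := AddSubgroup.toZModSubmodule p S
  have hlt : T < ⊤ := by
    refine lt_of_le_of_ne le_top fun h => hS ?_
    rw [eq_top_iff]
    intro x _
    have hx : x ∈ T := by
      rw [h]
      exact Submodule.mem_top
    exact (AddSubgroup.mem_toZModSubmodule p).1 hx
  obtain ⟨f, hf, hle⟩ := Submodule.exists_le_ker_of_lt_top T hlt
  refine ⟨f.toAddMonoidHom, fun h => hf (LinearMap.ext fun x => DFunLike.congr_fun h x),
    fun v hv => hle ((AddSubgroup.mem_toZModSubmodule p).2 hv)⟩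

theorem exists_zmod_functional {V : Type*} [AddCommGroup V] {p : ℕ} [Fact p.Prime]
    (hV : ∀ v : V, p • v = 0) {S : AddSubgroup V} (hS : S ≠ ⊤) :
    ∃ φ : V →+ ZMod p, φ ≠ 0 ∧ ∀ v ∈ S, φ v = 0 :=
  let _ : Module (ZMod p) V := AddCommGroup.zmodModule hV
  exists_zmod_functional_of_module hS

theorem surjective_of_ne_zero {V : Type*} [AddCommGroup V] {p : ℕ} [Fact p.Prime]
    {φ : V →+ ZMod p} (hφ : φ ≠ 0) : Function.Surjective φ := fun c => by
  obtain ⟨v, hv⟩ := DFunLike.ne_iff.1 hφ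
  refine ⟨(c / φ v).val • v, ?_⟩
  rw [map_nsmul, nsmul_eq_mul, ZMod.natCast_val, ZMod.cast_id]
  exact div_mul_cancel₀ c hv

theorem card_fiber_mul {V : Type*} [AddCommGroup V] [Fintype V] [DecidableEq V] {p : ℕ}
    [Fact p.Prime] {φ : V →+ ZMod p} (hφ : φ ≠ 0) (c : ZMod p) :
    (Finset.univ.filter fun v => φ v = c).card * p = Fintype.card V := by
  have h1 : ∀ d, (Finset.univ.filter fun v => φ v = d).card =
      (Finset.univ.filter fun v => φ v = c).card := fun d => by
    obtain ⟨w, hw⟩ := surjective_of_ne_zero hφ (c - d)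
    refine Finset.card_bij' (fun v _ => v + w) (fun v _ => v - w) ?_ ?_ ?_ ?_
    · intro v hv
      simp only [Finset.mem_filter, Finset.mem_univ, true_and] at hv ⊢
      rw [map_add, hv, hw, add_sub_cancel]
    · intro v hv
      simp only [Finset.mem_filter, Finset.mem_univ, true_and] at hv ⊢
      rw [map_sub, hv, hw, sub_sub_cancel]
    · intro v _
      exact add_sub_cancel_right v w
    · intro v _
      exact sub_add_cancel v w
  have h2 := Finset.card_eq_sum_card_fiberwise (s := (Finset.univ : Finset V))
    (t := (Finset.univ : Finset (ZMod p))) (f := φ) fun _ _ => Finset.mem_coe.2 (Finset.mem_univ _)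
  rw [← Finset.card_univ, h2, Finset.sum_congr rfl fun d _ => h1 d]
  simp [ZMod.card, mul_comm]

variable {F : Type*} [Field F] {p : ℕ} [Fact p.Prime] [CharP F p]

/-- Apply duality to the image of `H` in the quotient ring, which is proper by hypothesis. The
functional is the common obstruction behind (i) ⇒ (iii), (iv) ⇒ (iii) and the final claim. -/
theorem exists_functional_of_ne_top {P : F[X][X]} {Q : MonicPoly F}
    (h : valueGroup P ⊔ (Ideal.span {Q.1}).toAddSubgroup ≠ ⊤) :
    ∃ φ : QuotRing Q →+ ZMod p, φ ≠ 0 ∧ ∀ y, φ (aeval y P) = φ (aeval 0 P) := by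
  let mk : F[X] →+ QuotRing Q := (Ideal.Quotient.mk (Ideal.span {Q.1})).toAddMonoidHom
  have hp : ∀ v : QuotRing Q, p • v = 0 := fun v => by
    obtain ⟨x, rfl⟩ := Ideal.Quotient.mk_surjective v
    rw [← map_nsmul, nsmul_eq_mul, CharP.cast_eq_zero, zero_mul, map_zero]
  obtain ⟨φ, hφ, hφ0⟩ := exists_zmod_functional hp (S := (valueGroup P).map mk) fun htop => h <| by
    rw [eq_top_iff]
    intro x _
    obtain ⟨y, hy, hyx⟩ := (htop ▸ AddSubgroup.mem_top (mk x) : mk x ∈ (valueGroup P).map mk)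
    have h1 : x - y ∈ Ideal.span {Q.1} := Ideal.Quotient.eq.1 hyx.symm
    rw [← add_sub_cancel y x]
    exact AddSubgroup.add_mem_sup hy h1
  refine ⟨φ, hφ, fun y => ?_⟩
  obtain ⟨y, rfl⟩ := Ideal.Quotient.mk_surjective y
  have h1 := hφ0 (mk (P.eval y - P.eval 0))
    (AddSubgroup.mem_map_of_mem mk (AddSubgroup.subset_closure ⟨y, rfl⟩))
  rw [map_sub, map_sub, sub_eq_zero] at h1
  rw [aeval_quotRing, ← map_zero (Ideal.Quotient.mk (Ideal.span {Q.1})), aeval_quotRing]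
  exact h1

end Functional

/-! ### From character bounds to counting, and obstructions from a proper value group -/

section Implications

variable {F : Type*} [Field F] [Fintype F] {P : F[X][X]}

theorem FullValueGroup.powerSavingL2 (h : FullValueGroup P) : PowerSavingL2 P := by
  obtain ⟨C, hC, h⟩ := h
  refine ⟨C, P.natDegree + 1, (1 / 2 : ℝ) ^ P.natDegree, hC, by positivity, by positivity,
    fun Q hQ => ?_⟩
  have hpos : (0 : ℝ) < lpf Q := hC.trans_le hQ
  exact supDiscrepancy_le (fun χ hχ =>
    norm_expect_addChar_aeval_le (by exact_mod_cast hpos) (h Q hQ) hχ) (by positivity)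

theorem supDiscrepancy_nonneg (P : F[X][X]) (Q : MonicPoly F) : 0 ≤ supDiscrepancy P Q :=
  Real.iSup_nonneg fun _ => l2Norm_nonneg _

theorem PowerSavingL2.qualitativeL2 (h : PowerSavingL2 P) : QualitativeL2 P := by
  obtain ⟨C₁, C₂, γ, hC₁, hC₂, hγ, h⟩ := h
  have hlpf : Tendsto (fun Q : MonicPoly F => (lpf Q : ℝ)) (comap lpf atTop) atTop :=
    tendsto_intCast_atTop_atTop.comp tendsto_comap
  have h1 : Tendsto (fun Q : MonicPoly F => C₂ * (lpf Q : ℝ) ^ (-γ)) (comap lpf atTop) (𝓝 0) := by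
    simpa using ((tendsto_rpow_neg_atTop hγ).comp hlpf).const_mul C₂
  refine tendsto_of_tendsto_of_tendsto_of_le_of_le' tendsto_const_nhds h1
    (Eventually.of_forall fun Q => supDiscrepancy_nonneg P Q) ?_
  filter_upwards [hlpf.eventually_ge_atTop C₁] with Q hQ
  exact h Q hQ

theorem norm_expect_mul_le {S : Type*} [Fintype S] (g h : S → ℂ) :
    ‖𝔼 x, g x * h x‖ ≤ l2Norm g * l2Norm h := by
  have h1 : ‖𝔼 x, g x * h x‖ ≤ 𝔼 x, ‖g x‖ * ‖h x‖ := by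
    simpa only [norm_mul] using RCLike.norm_expect_le (K := ℝ) (f := fun x => g x * h x)
  refine h1.trans ?_
  rw [l2Norm, l2Norm, ← Real.sqrt_mul (Finset.expect_nonneg fun _ _ => by positivity)]
  refine Real.le_sqrt_of_sq_le ?_
  rw [Fintype.expect_eq_sum_div_card, Fintype.expect_eq_sum_div_card,
    Fintype.expect_eq_sum_div_card, div_pow, div_mul_div_comm, ← sq]
  gcongr
  exact Finset.sum_mul_sq_le_sq_mul_sq _ _ _

open scoped Classical in
/-- The indicator function of a finite set. -/
def indicatorFun {S : Type*} (A : Finset S) : S → ℂ := fun x => if x ∈ A then 1 else 0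

theorem l2Norm_indicatorFun {S : Type*} [Fintype S] (A : Finset S) :
    l2Norm (indicatorFun A) = √(A.card : ℝ) / √(Fintype.card S : ℝ) := by
  classical
  rw [l2Norm, ← Real.sqrt_div (by positivity), Fintype.expect_eq_sum_div_card]
  congr 2
  have : ∀ x, ‖indicatorFun A x‖ ^ 2 = if x ∈ A then (1 : ℝ) else 0 := fun x => by
    rw [indicatorFun]
    split_ifs <;> simp
  simp_rw [this]
  simp

theorem expect_indicatorFun_mul_discrepancy (Q : MonicPoly F) (A B : Finset (QuotRing Q)) :
    𝔼 x, indicatorFun A x * discrepancy P Q (indicatorFun B) x =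
      ((Nat.card {xy : QuotRing Q × QuotRing Q // xy.1 ∈ A ∧ xy.1 + aeval xy.2 P ∈ B} : ℂ)
        - A.card * B.card) / (Fintype.card (QuotRing Q)) ^ 2 := by
  classical
  have h1 : (Nat.card {xy : QuotRing Q × QuotRing Q // xy.1 ∈ A ∧ xy.1 + aeval xy.2 P ∈ B} : ℂ) =
      ∑ x, indicatorFun A x * ∑ y, indicatorFun B (x + aeval y P) := by
    rw [Nat.card_eq_fintype_card, Fintype.card_subtype, Finset.card_filter]
    simp_rw [Finset.mul_sum]
    rw [← Fintype.sum_prod_type' (f := fun x y : QuotRing Q =>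
      indicatorFun A x * indicatorFun B (x + aeval y P))]
    push_cast
    refine Finset.sum_congr rfl fun xy _ => ?_
    simp only [indicatorFun]
    split_ifs <;> simp_all
  have h2 : ∀ A : Finset (QuotRing Q), ∑ x, indicatorFun A x = A.card := fun A => by
    simp [indicatorFun]
  rw [h1, ← h2 A, ← h2 B, Fintype.expect_eq_sum_div_card]
  simp only [discrepancy, Fintype.expect_eq_sum_div_card]
  rw [Finset.sum_mul, ← Finset.sum_sub_distrib, Finset.sum_div, Finset.sum_div _ _ (_ ^ 2)]
  refine Finset.sum_congr rfl fun x _ => ?_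
  have : (Fintype.card (QuotRing Q) : ℂ) ≠ 0 := by exact_mod_cast Fintype.card_ne_zero
  field_simp

/-- The normalized counting error is the pairing of `1_A` with the discrepancy of `1_B`;
Cauchy–Schwarz and the operator bound finish. -/
theorem abs_card_sub_le (Q : MonicPoly F) (A B : Finset (QuotRing Q)) :
    |(Nat.card {xy : QuotRing Q × QuotRing Q // xy.1 ∈ A ∧ xy.1 + aeval xy.2 P ∈ B} : ℝ)
        - (A.card : ℝ) * (B.card : ℝ)| ≤
      supDiscrepancy P Q * √(A.card : ℝ) * √(B.card : ℝ) * (cardPowDegree Q.1 : ℝ) := by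
  have hcard : ((cardPowDegree Q.1 : ℤ) : ℝ) = Fintype.card (QuotRing Q) := by
    rw [← card_quotRing]
    simp
  set n : ℝ := (Fintype.card (QuotRing Q) : ℝ) with hn
  have hn0 : 0 < n := by
    rw [hn]
    exact_mod_cast Fintype.card_pos
  have h1 := norm_expect_mul_le (indicatorFun A) (discrepancy P Q (indicatorFun B))
  rw [expect_indicatorFun_mul_discrepancy, l2Norm_indicatorFun] at h1
  have h2 := l2Norm_discrepancy_le P Q (indicatorFun B)
  rw [l2Norm_indicatorFun] at h2
  set N := Nat.card {xy : QuotRing Q × QuotRing Q // xy.1 ∈ A ∧ xy.1 + aeval xy.2 P ∈ B}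
  have h3 : ((N : ℂ) - A.card * B.card) / (Fintype.card (QuotRing Q)) ^ 2 =
      ((((N : ℝ) - A.card * B.card) / n ^ 2 : ℝ) : ℂ) := by
    push_cast
    rfl
  rw [h3, Complex.norm_real, Real.norm_eq_abs, abs_div, abs_of_pos (by positivity : 0 < n ^ 2),
    div_le_iff₀ (by positivity)] at h1
  rw [hcard]
  have hs : √n * √n = n := Real.mul_self_sqrt hn0.le
  have hs0 : 0 < √n := Real.sqrt_pos.2 hn0
  calc _ ≤ _ := h1
    _ ≤ √(A.card : ℝ) / √n * (supDiscrepancy P Q * (√(B.card : ℝ) / √n)) * n ^ 2 := by gcongr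
    _ = supDiscrepancy P Q * √(A.card : ℝ) * √(B.card : ℝ) * (n * n / (√n * √n)) := by
      field_simp
    _ = _ := by rw [hs, mul_div_cancel_right₀ _ hn0.ne']

theorem PowerSavingL2.powerSavingCount (h : PowerSavingL2 P) : PowerSavingCount P := by
  obtain ⟨C₁, C₂, γ, hC₁, hC₂, hγ, h⟩ := h
  refine ⟨C₁, C₂, γ, hC₁, hC₂, hγ, fun Q hQ A B => (abs_card_sub_le Q A B).trans ?_⟩
  have h1 : (0 : ℝ) ≤ (cardPowDegree Q.1 : ℝ) := by
    exact_mod_cast AbsoluteValue.nonneg _ _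
  calc
    _ ≤ (C₂ * (lpf Q : ℝ) ^ (-γ)) * √(A.card : ℝ) * √(B.card : ℝ) * (cardPowDegree Q.1 : ℝ) := by
        gcongr
        exact h Q hQ
    _ = _ := by ring

/-- If no pair existed, the error would be all of `|A||B|`. Cancelling `√(|A||B|)` gives `√(|A||B|)
≤ C₂ |Q| lpf(Q)^(-γ)`, which is less than `√δ |Q|` once `lpf Q` is large. -/
theorem PowerSavingCount.twoSetSarkozy (h : PowerSavingCount P) : TwoSetSarkozy P := by
  obtain ⟨C₁, C₂, γ, hC₁, hC₂, hγ, h⟩ := h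
  intro δ hδ
  have h1 : Tendsto (fun x : ℝ => C₂ * x ^ (-γ)) atTop (𝓝 0) := by
    simpa using (tendsto_rpow_neg_atTop hγ).const_mul C₂
  obtain ⟨N, hN⟩ := eventually_atTop.1 (h1.eventually_lt_const (Real.sqrt_pos.2 hδ))
  refine ⟨max N C₁, lt_max_of_lt_right hC₁, fun Q hQ A B hAB => ?_⟩
  by_contra! hcon
  have h2 := h Q ((le_max_right _ _).trans hQ) A B
  have h3 := hN _ ((le_max_left _ _).trans hQ)
  have hempty : Nat.card
      {xy : QuotRing Q × QuotRing Q // xy.1 ∈ A ∧ xy.1 + aeval xy.2 P ∈ B} = 0 := by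
    rw [Nat.card_eq_zero]
    exact Or.inl ⟨fun xy => hcon _ _ xy.2.1 xy.2.2⟩
  have hpos : (0 : ℝ) < (cardPowDegree Q.1 : ℝ) := by
    exact_mod_cast AbsoluteValue.pos _ Q.2.ne_zero
  set q : ℝ := (cardPowDegree Q.1 : ℝ)
  set s : ℝ := √(A.card : ℝ) * √(B.card : ℝ) with hs
  have hs2 : (A.card : ℝ) * B.card = s ^ 2 := by
    rw [hs, mul_pow, Real.sq_sqrt (by positivity), Real.sq_sqrt (by positivity)]
  rw [hempty, Nat.cast_zero, zero_sub, abs_neg, abs_of_nonneg (by positivity), hs2] at h2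
  rw [hs2] at hAB
  have hsle : √δ * q ≤ s := by
    refine (sq_le_sq₀ (by positivity) (by positivity)).1 ?_
    rwa [mul_pow, Real.sq_sqrt hδ.le]
  have hspos : 0 < s := lt_of_lt_of_le (by positivity) hsle
  have h4 : s * s ≤ s * (q * (C₂ * (lpf Q : ℝ) ^ (-γ))) := by
    calc s * s = s ^ 2 := (sq s).symm
      _ ≤ _ := h2
      _ = _ := by rw [hs]; ring
  have h5 := le_of_mul_le_mul_left h4 hspos
  have h6 : q * (C₂ * (lpf Q : ℝ) ^ (-γ)) < q * √δ := mul_lt_mul_of_pos_left h3 hpos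
  linarith

/-- When `φ(P(y))` is constant, adding `P(y)` sends each fibre of `φ` into a single fibre. Two
mismatched fibres, each of density `1/p`, contradict the property with `δ = 1/p²`. -/
theorem TwoSetSarkozy.fullValueGroup (h : TwoSetSarkozy P) : FullValueGroup P := by
  classical
  obtain ⟨p, hp⟩ := CharP.exists F
  have : Fact p.Prime := ⟨CharP.char_is_prime F p⟩
  have hp0 : (0 : ℝ) < p := by exact_mod_cast (Fact.out : p.Prime).pos
  obtain ⟨N, hN, h⟩ := h (1 / p ^ 2) (by positivity)
  refine ⟨N, hN, fun Q hQ => ?_⟩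
  by_contra hne
  obtain ⟨φ, hφ, hφP⟩ := exists_functional_of_ne_top (p := p) hne
  have hcard : ((cardPowDegree Q.1 : ℤ) : ℝ) = Fintype.card (QuotRing Q) := by
    rw [← card_quotRing]
    simp
  have hfib : ∀ c, ((Finset.univ.filter fun v => φ v = c).card : ℝ) =
      Fintype.card (QuotRing Q) / p := fun c => by
    rw [eq_div_iff hp0.ne']
    exact_mod_cast card_fiber_mul hφ c
  obtain ⟨x, y, hx, hy⟩ := h Q hQ (Finset.univ.filter fun v => φ v = 0)
    (Finset.univ.filter fun v => φ v = φ (aeval 0 P) + 1) (by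
      rw [hfib, hfib, hcard]
      apply le_of_eq
      field_simp)
  simp only [Finset.mem_filter, Finset.mem_univ, true_and] at hx hy
  rw [map_add, hx, zero_add, hφP] at hy
  exact one_ne_zero (left_eq_add.1 hy)

/-- The character built from the obstructing functional is an eigenfunction of the discrepancy with
eigenvalue of modulus one, so the supremum cannot be below `1`. -/
theorem QualitativeL2.fullValueGroup (h : QualitativeL2 P) : FullValueGroup P := by
  obtain ⟨p, hp⟩ := CharP.exists F
  have : Fact p.Prime := ⟨CharP.char_is_prime F p⟩
  have h1 := h.eventually_lt_const (zero_lt_one)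
  rw [eventually_comap] at h1
  obtain ⟨N, hN⟩ := eventually_atTop.1 h1
  refine ⟨max N 1, lt_max_of_lt_right one_pos, fun Q hQ => ?_⟩
  by_contra hne
  obtain ⟨φ, hφ, hφP⟩ := exists_functional_of_ne_top (p := p) hne
  have h2 := hN (lpf Q) (by exact_mod_cast (le_max_left _ _).trans hQ) Q rfl
  let χ : AddChar (QuotRing Q) ℂ := (ZMod.stdAddChar (N := p)).compAddMonoidHom φ
  have hχ : χ ≠ 1 := AddChar.ne_one_iff.2 <| by
    obtain ⟨x, hx⟩ := surjective_of_ne_zero hφ 1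
    refine ⟨x, fun h => one_ne_zero (α := ZMod p) (ZMod.injective_stdAddChar ?_)⟩
    rw [AddChar.map_zero_eq_one, ← h, AddChar.compAddMonoidHom_apply, hx]
  have h3 := l2Norm_discrepancy_le P Q χ
  have h4 : discrepancy P Q χ = fun x => χ x * χ (aeval 0 P) := by
    funext x
    have h5 : ∀ y : QuotRing Q, χ (aeval y P) = χ (aeval 0 P) := fun y => by
      simp only [χ, AddChar.compAddMonoidHom_apply, hφP]
    simp only [discrepancy, AddChar.map_add_eq_mul, h5]
    rw [Fintype.expect_const, AddChar.expect_eq_zero_iff_ne_zero.2 hχ, sub_zero]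
  have h6 : l2Norm χ = 1 := by
    simp [l2Norm, AddChar.norm_apply]
  have h7 : l2Norm (discrepancy P Q χ) = 1 := by
    rw [h4]
    simp [l2Norm, AddChar.norm_apply]
  rw [h6, h7, mul_one] at h3
  linarith

end Implications

/-! ### Irrational equidistribution -/

theorem uncountable_fun (ι : Type*) [Infinite ι] (α : Type*) [Nontrivial α] :
    Uncountable (ι → α) := by
  classical
  rw [← not_countable_iff]
  intro h
  obtain ⟨f, hf⟩ := exists_injective_nat (ι → α)
  obtain ⟨a, b, hab⟩ := exists_pair_ne α
  refine Function.cantor_injective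
    (fun s : Set ι => Infinite.natEmbedding ι (f fun i => if i ∈ s then a else b)) fun s t hst => ?_
  have h1 := hf ((Infinite.natEmbedding ι).injective hst)
  ext i
  have h2 := congrFun h1 i
  by_cases hs : i ∈ s <;> by_cases ht : i ∈ t <;> simp_all

theorem countable_polynomial (F : Type*) [Field F] [Finite F] : Countable F[X] := by
  rw [← Cardinal.mk_le_aleph0_iff]
  exact Polynomial.cardinalMk_le_max.trans (max_le Cardinal.mk_le_aleph0 le_rfl)

/-! ### Duality between `𝔽[t]` and `𝔽((t⁻¹))` by residue and trace -/

section Residue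

variable (F : Type*) [Field F] (p : ℕ) [Fact p.Prime] [Algebra (ZMod p) F]

/-- The trace of the coefficient of `t⁻¹`, as a functional on `𝔽((t⁻¹)) / 𝔽[t]`. -/
def torusFunctional : Torus F →+ ZMod p :=
  QuotientAddGroup.lift _
    ((Algebra.trace (ZMod p) F).toAddMonoidHom.comp
      { toFun := fun α : LaurentSeries F => α.coeff 1
        map_zero' := rfl
        map_add' := fun _ _ => rfl })
    (by
      rintro _ ⟨f, rfl⟩
      have : (embed F f).coeff 1 = 0 := by rw [coeff_embed, if_neg (by norm_num)]
      simp [AddMonoidHom.mem_ker, this])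

theorem torusFunctional_mk (α : LaurentSeries F) :
    torusFunctional F p (QuotientAddGroup.mk α) = Algebra.trace (ZMod p) F (α.coeff 1) := rfl

/-- The additive character of `𝔽((t⁻¹)) / 𝔽[t]` given by the trace of the coefficient of `t⁻¹`. -/
def torusChar : AddChar (Torus F) ℂ :=
  (ZMod.stdAddChar (N := p)).compAddMonoidHom (torusFunctional F p)

theorem continuous_torusChar : Continuous (torusChar F p) := by
  have h : Continuous fun α : LaurentSeries F =>
      ZMod.stdAddChar (N := p) (Algebra.trace (ZMod p) F (α.coeff 1)) := by
    let _ : UniformSpace F := ⊥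
    have : DiscreteTopology F := ⟨rfl⟩
    have h1 := (LaurentSeries.uniformContinuous_coeff (K := F) 1).continuous
    exact (continuous_of_discreteTopology
      (f := fun x : F => ZMod.stdAddChar (N := p) (Algebra.trace (ZMod p) F x))).comp h1
  exact continuous_coinduced_dom.2 h

variable [Fintype F]

theorem exists_torusChar_ne_one : ∃ x, torusChar F p x ≠ 1 := by
  obtain ⟨a, ha⟩ := Algebra.trace_surjective (ZMod p) F 1
  refine ⟨QuotientAddGroup.mk (fracSeries fun _ => a), fun h => one_ne_zero (α := ZMod p)
    (ZMod.injective_stdAddChar ?_)⟩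
  rw [AddChar.map_zero_eq_one, ← h, torusChar, AddChar.compAddMonoidHom_apply, torusFunctional_mk]
  have := coeff_fracSeries (fun _ => a) 0
  rw [Nat.cast_zero, zero_add] at this
  rw [this, ha]

/-- Translating by a point where the character is not `1` multiplies the integral by a factor other
than `1`. -/
theorem integral_torusChar : ∫ x, torusChar F p x ∂torusHaar F = 0 := by
  have : (torusHaar F).IsAddHaarMeasure := by
    unfold torusHaar
    infer_instance
  obtain ⟨g, hg⟩ := exists_torusChar_ne_one F p
  have h1 := integral_add_left_eq_self (μ := torusHaar F) (fun x => torusChar F p x) g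
  simp_rw [AddChar.map_add_eq_mul] at h1
  rw [integral_const_mul] at h1
  exact (mul_left_eq_self₀.1 h1).resolve_left hg

/-- Every functional on `𝔽[t]` is given by an element of `𝔽((t⁻¹))`. -/
theorem exists_laurentSeries_functional (φ : F[X] →+ ZMod p) :
    ∃ α : LaurentSeries F, ∀ h, φ h = Algebra.trace (ZMod p) F ((embed F h * α).coeff 1) := by
  have h1 : ∀ j : ℕ, ∃ c : F, ∀ a, φ (monomial j a) = Algebra.trace (ZMod p) F (a * c) := by
    intro j
    let f : F →ₗ[ZMod p] ZMod p :=
      (φ.comp (monomial (R := F) j).toAddMonoidHom).toZModLinearMap p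
    have hB := traceForm_nondegenerate (ZMod p) F
    refine ⟨((Algebra.traceForm (ZMod p) F).toDual hB).symm f, fun a => ?_⟩
    have := LinearMap.BilinForm.apply_toDual_symm_apply (hB := hB) f a
    rw [Algebra.traceForm_apply, mul_comm] at this
    exact this.symm
  choose c hc using h1
  -- The coefficient `c j` sits at `t^(-j-1)`, so that multiplication by `t^j` brings it to the
  -- residue position `t⁻¹`.
  refine ⟨fracSeries c, fun h => ?_⟩
  induction h using Polynomial.induction_on' with
  | add f g hf hg => rw [map_add, hf, hg, map_add, add_mul, HahnSeries.coeff_add, map_add]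
  | monomial j a =>
    have h2 := HahnSeries.coeff_single_mul_add (r := a) (x := fracSeries c) (a := (j : ℤ) + 1)
      (b := -(j : ℤ))
    rw [add_neg_cancel_comm, coeff_fracSeries] at h2
    rw [hc, embed_monomial, h2]

end Residue

/-- The polynomials of degree less than `N` form a Følner sequence. -/
theorem exists_isFolner (F : Type*) [Field F] [Finite F] : ∃ Φ : ℕ → Finset F[X], IsFolner Φ := by
  classical
  have hfin : ∀ N : ℕ, (degreeLT F N : Set F[X]).Finite := fun N => by
    have : Finite (degreeLT F N) := Module.finite_of_finite F
    exact Set.toFinite _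
  have hmem : ∀ N f, f ∈ (hfin N).toFinset ↔ f ∈ degreeLT F N := fun N f => by simp
  refine ⟨fun N => (hfin N).toFinset, fun N => ⟨0, by simp⟩, fun n => ?_⟩
  refine tendsto_const_nhds.congr' ?_
  -- Once `N` exceeds the degree of `n`, the set is a group containing `n`, so translation fixes it
  -- and the symmetric difference is empty.
  filter_upwards [eventually_gt_atTop n.natDegree] with N hN
  have hn : n ∈ degreeLT F N := by
    rw [mem_degreeLT]
    exact lt_of_le_of_lt degree_le_natDegree (by exact_mod_cast hN)
  have h1 : (hfin N).toFinset.image (· + n) = (hfin N).toFinset := by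
    ext f
    rw [Finset.mem_image, hmem]
    constructor
    · rintro ⟨g, hg, rfl⟩
      exact Submodule.add_mem _ ((hmem _ _).1 hg) hn
    · intro hf
      exact ⟨f - n, (hmem _ _).2 (Submodule.sub_mem _ hf hn), sub_add_cancel f n⟩
  rw [eq_comm, div_eq_zero_iff]
  left
  rw [Nat.cast_eq_zero, Finset.card_eq_zero]
  rw [h1]
  exact symmDiff_self _

/-! ### Finiteness of the annihilator of the value group -/

section Good

variable {F : Type*} [Field F] [Fintype F] {p : ℕ} [Fact p.Prime] {P : F[X][X]}

/-- If `α` annihilates `H`, the residue character is constant along `P(n)α`, so its averages have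
modulus one. Well-distribution would force them to tend to the integral `0`. -/
theorem GoodForIrrationalEquidistribution.isRational [Algebra (ZMod p) F]
    (h : GoodForIrrationalEquidistribution P) {α : LaurentSeries F}
    (hα : ∀ x ∈ valueGroup P, Algebra.trace (ZMod p) F ((embed F x * α).coeff 1) = 0) :
    IsRational α := by
  by_contra hirr
  obtain ⟨Φ, hΦ⟩ := exists_isFolner F
  have h1 := h α hirr (torusChar F p) (continuous_torusChar F p) Φ hΦ
  have h2 : ∀ n, torusChar F p (QuotientAddGroup.mk (embed F (P.eval n) * α)) =
      torusChar F p (QuotientAddGroup.mk (embed F (P.eval 0) * α)) := fun n => by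
    have h3 := hα _ (AddSubgroup.subset_closure ⟨n, rfl⟩)
    rw [map_sub, sub_mul, HahnSeries.coeff_sub, map_sub, sub_eq_zero] at h3
    simp only [torusChar, AddChar.compAddMonoidHom_apply, torusFunctional_mk, h3]
  have h4 : ∀ N, 𝔼 n ∈ Φ N, torusChar F p (QuotientAddGroup.mk (embed F (P.eval n) * α)) =
      torusChar F p (QuotientAddGroup.mk (embed F (P.eval 0) * α)) := fun N => by
    rw [Finset.expect_congr rfl fun n _ => h2 n, Finset.expect_const (hΦ.nonempty N)]
  simp_rw [h4] at h1
  rw [integral_torusChar] at h1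
  exact (AddChar.val_isUnit _ _).ne_zero (tendsto_nhds_unique tendsto_const_nhds h1)

theorem countable_isRational (F : Type*) [Field F] [Finite F] :
    {α : LaurentSeries F | IsRational α}.Countable := by
  have := countable_polynomial F
  refine (Set.countable_range fun mn : F[X] × F[X] => embed F mn.1 / embed F mn.2).mono ?_
  rintro α ⟨m, n, -, rfl⟩
  exact ⟨(m, n), rfl⟩

theorem GoodForIrrationalEquidistribution.countable (p : ℕ) [Fact p.Prime] [CharP F p]
    (h : GoodForIrrationalEquidistribution P) :
    {φ : F[X] →+ ZMod p | ∀ x ∈ valueGroup P, φ x = 0}.Countable := by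
  let _ : Algebra (ZMod p) F := ZMod.algebra F p
  choose α hα using exists_laurentSeries_functional F p
  refine Set.MapsTo.countable_of_injOn (f := α) (t := {α | IsRational α}) (fun φ hφ => ?_)
    (fun φ _ φ' _ heq => ?_) (countable_isRational F)
  · exact h.isRational (p := p) fun x hx => by rw [← hα, hφ x hx]
  · refine DFunLike.ext _ _ fun x => ?_
    rw [hα, hα, heq]

/-- A vector space over `ZMod p` with countable dual has finite dual. -/
theorem finite_dual_of_countable {W : Type*} [AddCommGroup W] [Module (ZMod p) W]
    (h : Countable (W →+ ZMod p)) : Finite (W →+ ZMod p) := by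
  let b := Module.Basis.ofVectorSpace (ZMod p) W
  rcases finite_or_infinite (Module.Basis.ofVectorSpaceIndex (ZMod p) W) with hfin | hinf
  · have : Module.Finite (ZMod p) W := Module.Finite.of_basis b
    have : Finite W := Module.finite_of_finite (ZMod p)
    exact DFunLike.finite _
  · exfalso
    -- Functionals may be prescribed freely on a basis, so an infinite basis produces an uncountable
    -- dual.
    have hun := uncountable_fun (Module.Basis.ofVectorSpaceIndex (ZMod p) W) (ZMod p)
    refine not_countable_iff.2 hun (Function.Injective.countable
      (f := fun g => (b.constr ℕ g).toAddMonoidHom) fun g g' hgg => ?_)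
    refine (b.constr ℕ).injective (LinearMap.ext fun x => DFunLike.congr_fun hgg x)

/-- The annihilator of `H` is the full dual of the `𝔽_p`-space `𝔽[t]/H`, so countability upgrades to
finiteness. -/
theorem GoodForIrrationalEquidistribution.finite (p : ℕ) [Fact p.Prime] [CharP F p]
    (h : GoodForIrrationalEquidistribution P) :
    {φ : F[X] →+ ZMod p | ∀ x ∈ valueGroup P, φ x = 0}.Finite := by
  let e : (F[X] ⧸ valueGroup P →+ ZMod p) →
      {φ : F[X] →+ ZMod p | ∀ x ∈ valueGroup P, φ x = 0} := fun ψ =>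
    ⟨ψ.comp (QuotientAddGroup.mk' _), fun x hx => by
      rw [AddMonoidHom.comp_apply, QuotientAddGroup.mk'_apply,
        (QuotientAddGroup.eq_zero_iff x).2 hx, map_zero]⟩
  have he : Function.Injective e := fun ψ ψ' hψ => by
    refine QuotientAddGroup.addMonoidHom_ext _ (congrArg Subtype.val hψ)
  have he' : Function.Surjective e := fun φ =>
    ⟨QuotientAddGroup.lift _ φ.1 φ.2, Subtype.ext (by ext; rfl)⟩
  have hp : ∀ v : F[X] ⧸ valueGroup P, p • v = 0 := fun v => by
    obtain ⟨x, rfl⟩ := QuotientAddGroup.mk_surjective v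
    rw [← QuotientAddGroup.mk_nsmul, nsmul_eq_mul, CharP.cast_eq_zero, zero_mul,
      QuotientAddGroup.mk_zero]
  let _ : Module (ZMod p) (F[X] ⧸ valueGroup P) := AddCommGroup.zmodModule hp
  have hcount : Countable {φ : F[X] →+ ZMod p | ∀ x ∈ valueGroup P, φ x = 0} :=
    (h.countable p).to_subtype
  have := finite_dual_of_countable (p := p) he.countable
  have := Finite.of_surjective e he'
  exact Set.toFinite _

theorem lpf_le_of_not_isCoprime {Q : MonicPoly F} {Q' : F[X]} (hQ' : Q' ≠ 0)
    (h : ¬ IsCoprime Q.1 Q') : lpf Q ≤ cardPowDegree Q' := by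
  classical
  have h1 : ∃ z, Irreducible z ∧ z ∣ Q.1 ∧ z ∣ Q' := by
    by_contra! hcon
    exact h (isCoprime_of_irreducible_dvd (fun h0 => hQ' h0.2) hcon)
  obtain ⟨z, hz, hzQ, hzQ'⟩ := h1
  have hass := normalize_associated z
  have hdvd : normalize z ∣ Q' := hass.dvd.trans hzQ'
  refine (lpf_le_of_dvd (Polynomial.monic_normalize hz.ne_zero)
    (hass.symm.irreducible hz) (hass.dvd.trans hzQ)).trans ?_
  rw [cardPowDegree_nonzero _ (ne_zero_of_dvd_ne_zero hQ' hdvd), cardPowDegree_nonzero _ hQ']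
  exact pow_le_pow_right₀ (by exact_mod_cast Fintype.card_pos) (natDegree_le_of_dvd hdvd hQ')

theorem GoodForIrrationalEquidistribution.fullValueGroup
    (h : GoodForIrrationalEquidistribution P) : FullValueGroup P := by
  classical
  obtain ⟨p, hp⟩ := CharP.exists F
  have : Fact p.Prime := ⟨CharP.char_is_prime F p⟩
  have hfin := h.finite p
  -- Fix one nonzero `Q'` with `φ` zero on its multiples, if there is any. A `Q` coprime to `Q'`
  -- with the same property would give `φ = 0` by Bézout, so `Q` shares a factor with `Q'` and `lpf
  -- Q ≤ |Q'|`.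
  have h1 : ∀ φ : F[X] →+ ZMod p, ∃ b : ℤ, 0 ≤ b ∧ (φ ≠ 0 → ∀ Q : MonicPoly F,
      (∀ x, φ (Q.1 * x) = 0) → lpf Q ≤ b) := fun φ => by
    by_cases hφ : ∃ Q' : F[X], Q' ≠ 0 ∧ ∀ x, φ (Q' * x) = 0
    · obtain ⟨Q', hQ', hφQ'⟩ := hφ
      refine ⟨cardPowDegree Q', AbsoluteValue.nonneg _ _, fun hφ0 Q hQ =>
        lpf_le_of_not_isCoprime hQ' fun hcop => hφ0 ?_⟩
      obtain ⟨u, v, huv⟩ := hcop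
      refine DFunLike.ext _ _ fun x => ?_
      have : x = Q.1 * (u * x) + Q' * (v * x) := by linear_combination -x * huv
      rw [this, map_add, hQ, hφQ', AddMonoidHom.zero_apply, add_zero]
    · exact ⟨0, le_rfl, fun _ Q hQ => absurd ⟨Q.1, Q.2.ne_zero, hQ⟩ hφ⟩
  choose b hb0 hb using h1
  -- The sum of the nonnegative bounds serves as one bound for the whole finite annihilator.
  set B : ℤ := ∑ φ ∈ hfin.toFinset, b φ with hB
  have hB0 : 0 ≤ B := Finset.sum_nonneg fun φ _ => hb0 φ
  refine ⟨B + 1, by exact_mod_cast (by omega : 0 < B + 1), fun Q hQ => ?_⟩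
  by_contra hne
  obtain ⟨φ, hφ, hφP⟩ := exists_functional_of_ne_top (p := p) hne
  let φ' : F[X] →+ ZMod p := φ.comp (Ideal.Quotient.mk (Ideal.span {Q.1})).toAddMonoidHom
  have hφ'0 : φ' ≠ 0 := fun h0 => hφ <| by
    refine DFunLike.ext _ _ fun x => ?_
    obtain ⟨x, rfl⟩ := Ideal.Quotient.mk_surjective x
    exact DFunLike.congr_fun h0 x
  have hφ'Q : ∀ x, φ' (Q.1 * x) = 0 := fun x => by
    have : Ideal.Quotient.mk (Ideal.span {Q.1}) (Q.1 * x) = 0 :=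
      Ideal.Quotient.eq_zero_iff_mem.2 (Ideal.mem_span_singleton.2 (dvd_mul_right _ _))
    change φ (Ideal.Quotient.mk (Ideal.span {Q.1}) (Q.1 * x)) = 0
    rw [this, map_zero]
  have hmem : φ' ∈ hfin.toFinset := by
    rw [Set.Finite.mem_toFinset]
    intro x hx
    have hle : valueGroup P ≤ φ'.ker := by
      refine (AddSubgroup.closure_le _).2 ?_
      rintro _ ⟨y, rfl⟩
      have h2 : ∀ y, φ' (P.eval y) = φ (aeval 0 P) := fun y => by
        rw [← hφP (Ideal.Quotient.mk _ y), aeval_quotRing]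
        rfl
      change φ' (P.eval y - P.eval 0) = 0
      rw [map_sub, h2, h2, sub_self]
    exact hle hx
  have h3 := hb φ' hφ'0 Q hφ'Q
  have h4 : b φ' ≤ B := Finset.single_le_sum (fun φ _ => hb0 φ) hmem
  have h5 : B + 1 ≤ lpf Q := by exact_mod_cast hQ
  omega

end Good

end PolyEquidist

end

theorem mainTheorem4 {F : Type*} [Field F] [Fintype F] (P : Polynomial (Polynomial F))
    (hP : 0 < P.natDegree) :
    List.TFAE [PolyEquidist.QualitativeL2 P, PolyEquidist.PowerSavingL2 P,
      PolyEquidist.FullValueGroup P, PolyEquidist.TwoSetSarkozy P,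
      PolyEquidist.PowerSavingCount P] ∧
    (PolyEquidist.GoodForIrrationalEquidistribution P →
      PolyEquidist.QualitativeL2 P ∧ PolyEquidist.PowerSavingL2 P ∧
      PolyEquidist.FullValueGroup P ∧ PolyEquidist.TwoSetSarkozy P ∧
      PolyEquidist.PowerSavingCount P) := by
  refine ⟨?_, fun h => ?_⟩
  · tfae_have 1 → 3 := fun h => h.fullValueGroup
    tfae_have 3 → 2 := fun h => h.powerSavingL2
    tfae_have 2 → 1 := fun h => h.qualitativeL2
    tfae_have 2 → 5 := fun h => h.powerSavingCount
    tfae_have 5 → 4 := fun h => h.twoSetSarkozy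
    tfae_have 4 → 3 := fun h => h.fullValueGroup
    tfae_finish
  · have h2 := h.fullValueGroup.powerSavingL2
    exact ⟨h2.qualitativeL2, h2, h.fullValueGroup, h2.powerSavingCount.twoSetSarkozy,
      h2.powerSavingCount⟩
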